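/- Let $\mathbb T=\mathbb R/\mathbb Z$, let $\omega\in\mathbb R\setminus\mathbb Q$ and $\tau,\alpha,\beta\in\mathbb R$, and let $f:\mathbb T\times\mathbb T\to\mathbb T\times\mathbb T$ be the quasiperiodically forced Arnold map $$f(\theta,\varphi)=\Bigl(\theta+\omega,\ \varphi+\tau+\tfrac{\alpha}{2\pi}\sin(2\pi\varphi)+\beta\sin(2\pi\theta)\bmod 1\Bigr).$$ Let $\pi:\mathbb T\times\mathbb R\to\mathbb T\times\mathbb T$ be the natural projection, let $F:\mathbb T\times\mathbb R\to\mathbb T\times\mathbb R$ be any continuous lift of $f$ (that is, $\pi\circ F=f\circ\pi$), and write $F^n(\theta,x)=(\theta+n\omega,F^n_\theta(x))$. The fibred rotation interval is $$\rho_{\mathrm{fib}}(F)=\Bigl\{\limsup_{n\to\infty}\tfrac1n\bigl(F^n_\theta(x)-x\bigr)\ :\ (\theta,x)\in\mathbb T\times\mathbb R\Bigr\}.$$ A minimal set of $f$ is a non-empty closed set $M$ with $f(M)\subseteq M$ that has no proper non-empty closed subset $N$ with $f(N)\subseteq N$. A compact set $M\subseteq\mathbb T\times\mathbb T$ is a strangely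 dispersed minimal set if it is a minimal set of $f$, every connected component of $M$ projects to a single point under the projection $\pi_1$ to the first coordinate, and for every $z\in M$ and every open neighbourhood $U$ of $z$ the set $\pi_1(U\cap M)$ contains a non-empty open interval. (a) If $\alpha>1$ and $|\beta|\ge\frac32$, then for every $\rho\in\rho_{\mathrm{fib}}(F)$ there is a strangely dispersed minimal set $M_\rho$ such that (i) $\frac1n(F^n_\theta(x)-x)$ converges to $\rho$ uniformly on $\pi^{-1}(M_\rho)$ as $n\to\infty$, and (ii) the topological entropy of $f|_{M_\rho}$ is $0$. (b) If $|\alpha|\ge\frac52\pi$, then $\rho_{\mathrm{fib}}(F)$ is a compact interval of length at least $1$; in particular its interior is non-empty. (c) If the conditions of (a) and (b) both hold, then the sets $M_\rho$, $\rho\in\rho_{\mathrm{fib}}(F)$, in (a) can be chosen pairwise disjoint, and they form an uncountable family of strangely dispersed minimal sets. -/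

import Mathlib

open Set Filter Topology

namespace QPF

noncomputable section

/-- The circle `𝕋 = ℝ/ℤ`. -/
abbrev Circ : Type := UnitAddCircle

/-- The natural projection `𝕋 × ℝ → 𝕋 × 𝕋`. -/
def proj (z : Circ × ℝ) : Circ × Circ := (z.1, (z.2 : Circ))

theorem sin_two_pi_periodic :
    Function.Periodic (fun x : ℝ => Real.sin (2 * Real.pi * x)) 1 := by
  intro x
  simp only [mul_add, mul_one, Real.sin_add_two_pi]

/-- The function `x ↦ sin (2πx)` on the circle `ℝ/ℤ`. -/
def sinCirc (x : Circ) : ℝ := sin_two_pi_periodic.lift x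

/-- The quasiperiodically forced Arnold circle map
`f(θ, φ) = (θ + ω, φ + τ + α/(2π) sin(2πφ) + β sin(2πθ) mod 1)`. -/
def arnold (ω τ α β : ℝ) (z : Circ × Circ) : Circ × Circ :=
  (z.1 + (ω : Circ),
    z.2 + ((τ + α / (2 * Real.pi) * sinCirc z.2 + β * sinCirc z.1 : ℝ) : Circ))

/-- `F : 𝕋 × ℝ → 𝕋 × ℝ` is a (continuous) lift of `f : 𝕋 × 𝕋 → 𝕋 × 𝕋`. -/
structure IsLift (f : Circ × Circ → Circ × Circ) (F : Circ × ℝ → Circ × ℝ) : Prop where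
  continuous : Continuous F
  semiconj : ∀ z, proj (F z) = f (proj z)

/-- The standard lift of the forced Arnold map. -/
def arnoldLift (ω τ α β : ℝ) (z : Circ × ℝ) : Circ × ℝ :=
  (z.1 + (ω : Circ),
    z.2 + τ + α / (2 * Real.pi) * Real.sin (2 * Real.pi * z.2) + β * sinCirc z.1)

theorem continuous_sinCirc : Continuous sinCirc :=
  Continuous.quotient_lift (s := QuotientAddGroup.leftRel (AddSubgroup.zmultiples (1 : ℝ)))
    (f := fun x : ℝ => Real.sin (2 * Real.pi * x)) (by fun_prop) _

/-- Lifts of the forced Arnold map exist. -/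
theorem isLift_arnoldLift (ω τ α β : ℝ) :
    IsLift (arnold ω τ α β) (arnoldLift ω τ α β) where
  continuous := by
    have := continuous_sinCirc
    unfold arnoldLift
    fun_prop
  semiconj z := by
    have h : sinCirc (z.2 : Circ) = Real.sin (2 * Real.pi * z.2) := rfl
    simp only [proj, arnold, arnoldLift, h]
    congr 1
    rw [← AddCircle.coe_add]
    congr 1
    ring

/-- The average displacement `(F^n_θ(x) - x) / n` in the fibre, at `z = (θ, x)`. -/
def avgDisp (F : Circ × ℝ → Circ × ℝ) (n : ℕ) (z : Circ × ℝ) : ℝ :=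
  ((F^[n] z).2 - z.2) / n

/-- The fibred rotation interval of a lift `F`: the set of all upper limits of
`(F^n_θ(x) - x) / n`. (For lifts of maps homotopic to the identity these sequences are bounded,
so that the real-valued `limsup` is the usual one.) -/
def fibRot (F : Circ × ℝ → Circ × ℝ) : Set ℝ :=
  {ρ | ∃ z : Circ × ℝ, ρ = limsup (fun n : ℕ => avgDisp F n z) atTop}

/-- `M` is a minimal set of `f`: non-empty, closed, `f`-invariant, with no proper non-empty closed
`f`-invariant subset. -/
structure IsMinimalSet {X : Type*} [TopologicalSpace X] (f : X → X) (M : Set X) : Prop where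
  nonempty : M.Nonempty
  isClosed : IsClosed M
  mapsTo : MapsTo f M M
  eq_of_subset : ∀ N ⊆ M, N.Nonempty → IsClosed N → MapsTo f N N → N = M

/-- Strangely dispersed minimal sets. -/
structure IsStrangelyDispersed (f : Circ × Circ → Circ × Circ) (M : Set (Circ × Circ)) :
    Prop where
  isCompact : IsCompact M
  minimal : IsMinimalSet f M
  /-- Every connected component of `M` lies in a single fibre. -/
  component : ∀ z ∈ M, ∃ θ : Circ, Prod.fst '' connectedComponentIn M z = {θ}
  /-- Every relatively open non-empty piece of `M` projects onto a set containing a non-empty open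
  interval of the circle. -/
  dispersed : ∀ z ∈ M, ∀ U : Set (Circ × Circ), IsOpen U → z ∈ U →
    ∃ a b : ℝ, a < b ∧ (fun t : ℝ => (t : Circ)) '' Ioo a b ⊆ Prod.fst '' (U ∩ M)

/-- `(F^n_θ(x) - x) / n` converges to `ρ` uniformly on `π⁻¹(M)`. -/
def HasUniformRotation (F : Circ × ℝ → Circ × ℝ) (M : Set (Circ × Circ)) (ρ : ℝ) : Prop :=
  TendstoUniformlyOn (avgDisp F) (fun _ => ρ) atTop (proj ⁻¹' M)

/-- `h_top(f|_M) = 0`: the restriction of `f` to the `f`-invariant set `M` has zero topological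
entropy. -/
def ZeroEntropyOn (f : Circ × Circ → Circ × Circ) (M : Set (Circ × Circ)) : Prop :=
  ∃ h : MapsTo f M M, Dynamics.coverEntropy (h.restrict f M M) univ = 0

end

end QPF

namespace QPF

noncomputable section

/-! The lift is a skew product `x ↦ G x + b θ` over a rotation, and only `G` may fail to be
monotone. For a monotone fibre map, displacements within a fibre differ by at most 1, so there is
one rotation number, attained uniformly and continuous in the fibre map (`exists_rotation`,
`continuous_rotation`). The general case reduces to this through `pour G μ`, monotone maps running
from `runInf G` to `runSup G`, each locally constant wherever it differs from `G`. The intermediate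
value theorem realises every ρ between the two extreme rotation numbers, and the extreme maps bound
all orbits of `G`, so `fibRot` is exactly the interval between them (`fibRot_skew`). For large |α|
the extreme maps differ by at least 1 everywhere, which gives length at least 1.

Fix `g = pour G μ` with rotation number ρ. An orbit of `g` that never meets a plateau of `g` is also
an orbit of `G`. Such orbits exist in every fibre: otherwise an iterate of the fibre map would be
locally constant, contrary to degree one. A minimal set `M` made of them inherits ρ. It has zero
entropy, because order preservation leaves only linearly many itinerary codes of length `N` in a
fibre (`zeroEntropyOn_of_skew`).

Dispersion is a Baire argument. As for components, a connected subset of `M` over the whole circle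
would avoid a plateau, and so would its image; this keeps the oscillation of the image height below
1, whereas the forcing swings by 2|β| and `g` can compensate by at most 1 (`fst_image_ne_univ`). So
no component covers the circle, the base coordinate lifts continuously to ℝ on `M`, and minimality
makes every component have zero extent (`eq_of_mem_connectedComponent`). Sets with different
rotation numbers are disjoint. -/

/-- Continuous monotone lifts of degree one circle maps. -/
structure IsMonoLift (g : ℝ → ℝ) : Prop where
  mono : Monotone g
  cont : Continuous g
  add_one : ∀ x, g (x + 1) = g x + 1

/-! ### Skew products and their displacement cocycle. -/

/-- The skew product `(θ, x) ↦ (θ + ω, g x + b θ)`. -/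
def skew (ω : Circ) (b : Circ → ℝ) (g : ℝ → ℝ) (z : Circ × ℝ) : Circ × ℝ :=
  (z.1 + ω, g z.2 + b z.1)

/-- The total displacement in the fibre after `n` steps. -/
def disp (F : Circ × ℝ → Circ × ℝ) (n : ℕ) (z : Circ × ℝ) : ℝ := (F^[n] z).2 - z.2

theorem avgDisp_eq (F : Circ × ℝ → Circ × ℝ) (n : ℕ) (z : Circ × ℝ) :
    avgDisp F n z = disp F n z / n := rfl

theorem disp_add (F : Circ × ℝ → Circ × ℝ) (m n : ℕ) (z : Circ × ℝ) :
    disp F (m + n) z = disp F m z + disp F n (F^[m] z) := by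
  simp only [disp, add_comm m n, Function.iterate_add_apply]
  ring

theorem abs_disp_le {F : Circ × ℝ → Circ × ℝ} {C : ℝ} (hC : ∀ z, |disp F 1 z| ≤ C) (n : ℕ)
    (z : Circ × ℝ) : |disp F n z| ≤ n * C := by
  induction n with
  | zero => simp [disp]
  | succ n ih =>
    rw [disp_add]
    push_cast
    linarith [abs_add_le (disp F n z) (disp F 1 (F^[n] z)), hC (F^[n] z)]

section

variable {ω : Circ} {b : Circ → ℝ} {g : ℝ → ℝ}

theorem iterate_skew_fst (n : ℕ) (z : Circ × ℝ) : ((skew ω b g)^[n] z).1 = z.1 + n • ω := by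
  induction n with
  | zero => simp
  | succ n ih =>
    rw [Function.iterate_succ_apply', skew, ih, succ_nsmul, add_assoc]

theorem iterate_skew_mono (hg : Monotone g) (n : ℕ) (θ : Circ) {x y : ℝ} (h : x ≤ y) :
    ((skew ω b g)^[n] (θ, x)).2 ≤ ((skew ω b g)^[n] (θ, y)).2 := by
  induction n with
  | zero => simpa
  | succ n ih =>
    rw [Function.iterate_succ_apply', Function.iterate_succ_apply']
    simp only [skew, iterate_skew_fst]
    gcongr
    exact hg ih

theorem map_add_int {g : ℝ → ℝ} (hg : ∀ x, g (x + 1) = g x + 1) (x : ℝ) (k : ℤ) :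
    g (x + k) = g x + k := by
  induction k using Int.induction_on with
  | zero => simp
  | succ k ih =>
    push_cast at *
    rw [← add_assoc, hg, ih, add_assoc]
  | pred k ih =>
    have := hg (x + ((-k - 1 : ℤ) : ℝ))
    push_cast at *
    rw [show x + (-(k : ℝ) - 1) + 1 = x + -k by ring] at this
    linarith

theorem iterate_skew_add_int (hg : ∀ x, g (x + 1) = g x + 1) (n : ℕ) (θ : Circ) (x : ℝ) (k : ℤ) :
    ((skew ω b g)^[n] (θ, x + k)).2 = ((skew ω b g)^[n] (θ, x)).2 + k := by
  induction n with
  | zero => simp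
  | succ n ih =>
    rw [Function.iterate_succ_apply', Function.iterate_succ_apply']
    simp only [skew, iterate_skew_fst]
    rw [ih, map_add_int hg]
    ring

/-- An integer shift puts `y` in `[x, x + 1)`. Iterates preserve order and commute with integer
shifts, so the images are again at most 1 apart, in the same order. -/
theorem abs_disp_sub_disp_le (hg : IsMonoLift g) (n : ℕ) (θ : Circ) (x y : ℝ) :
    |disp (skew ω b g) n (θ, x) - disp (skew ω b g) n (θ, y)| ≤ 1 := by
  have h1 := iterate_skew_add_int (ω := ω) (b := b) hg.add_one n θ (y - ⌊y - x⌋) ⌊y - x⌋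
  rw [sub_add_cancel] at h1
  have h2 := iterate_skew_add_int (ω := ω) (b := b) hg.add_one n θ x 1
  have h3 := iterate_skew_mono (ω := ω) (b := b) hg.mono n θ
    (show x ≤ y - ⌊y - x⌋ by linarith [Int.floor_le (y - x)])
  have h4 := iterate_skew_mono (ω := ω) (b := b) hg.mono n θ
    (show y - ⌊y - x⌋ ≤ x + (1 : ℤ) by push_cast; linarith [Int.lt_floor_add_one (y - x)])
  have := Int.floor_le (y - x)
  have := Int.lt_floor_add_one (y - x)
  simp only [disp]
  rw [h1, abs_le]
  push_cast at *
  constructor <;> linarith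

theorem exists_abs_disp_le (hb : Continuous b) (hg : IsMonoLift g) :
    ∃ C, 0 ≤ C ∧ ∀ z, |disp (skew ω b g) 1 z| ≤ C := by
  obtain ⟨B, hB⟩ := isCompact_univ.exists_bound_of_continuousOn hb.continuousOn
  refine ⟨|g 0| + |B| + 1, by positivity, fun z => ?_⟩
  have h1 := abs_disp_sub_disp_le (ω := ω) (b := b) hg 1 z.1 z.2 0
  have h2 : |disp (skew ω b g) 1 (z.1, 0)| ≤ |g 0| + |B| := by
    simp only [disp, skew, Function.iterate_one, sub_zero]
    exact (abs_add_le _ _).trans (add_le_add le_rfl ((hB z.1 (mem_univ _)).trans (le_abs_self _)))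
  have h3 := abs_sub_abs_le_abs_sub (disp (skew ω b g) 1 z) (disp (skew ω b g) 1 (z.1, 0))
  have : ((z.1, z.2) : Circ × ℝ) = z := rfl
  rw [this] at h1
  linarith

end

theorem continuous_iterate_skew {P : Type*} [TopologicalSpace P] {ω : Circ} {b : Circ → ℝ}
    {g : P → ℝ → ℝ} (hb : Continuous b) (hg : Continuous (fun p : P × ℝ => g p.1 p.2)) (n : ℕ) :
    Continuous (fun p : P × (Circ × ℝ) => (skew ω b (g p.1))^[n] p.2) := by
  induction n with
  | zero => exact continuous_snd
  | succ n ih =>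
    simp only [Function.iterate_succ_apply', skew]
    have := hg.comp (continuous_fst.prodMk (continuous_snd.comp ih))
    exact (by fun_prop : Continuous _).prodMk (this.add (by fun_prop))

/-! ### Existence and continuity of the rotation number. -/

/-- Two skew products whose `N`-step displacements are close over nearby base points stay close
up to a linear error with slope `3 / N`. -/
theorem abs_disp_sub_disp_mul_le {ω : Circ} {b : Circ → ℝ} {g g' : ℝ → ℝ} (hg : IsMonoLift g)
    (hg' : IsMonoLift g') {N : ℕ} {δ : ℝ}
    (h : ∀ θ θ' : Circ, dist θ θ' < δ →
      |disp (skew ω b g) N (θ, 0) - disp (skew ω b g') N (θ', 0)| ≤ 1)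
    (k : ℕ) {z z' : Circ × ℝ} (hz : dist z.1 z'.1 < δ) :
    |disp (skew ω b g) (k * N) z - disp (skew ω b g') (k * N) z'| ≤ 3 * k := by
  induction k with
  | zero => simp [disp]
  | succ k ih =>
    rw [add_mul, one_mul, disp_add, disp_add]
    set w := (skew ω b g)^[k * N] z
    set w' := (skew ω b g')^[k * N] z'
    have hw : dist w.1 w'.1 < δ := by
      simp only [w, w', iterate_skew_fst]
      rwa [dist_add_right]
    -- The 3 per block: replacing each of the two fibre points by 0 costs 1, and comparing the two
    -- maps at 0 costs 1.
    have h1 := abs_disp_sub_disp_le (ω := ω) (b := b) hg N w.1 w.2 0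
    have h2 := abs_disp_sub_disp_le (ω := ω) (b := b) hg' N w'.1 w'.2 0
    have h3 := h _ _ hw
    simp only [Prod.mk.eta] at h1 h2
    push_cast
    rw [abs_le] at *
    constructor <;> linarith [h1.1, h1.2, h2.1, h2.2, h3.1, h3.2, ih.1, ih.2]

/-- Split `n` into `n / N` full blocks, each costing 3, and fewer than `N` leftover steps, each
costing at most `C` for either map. -/
theorem abs_disp_sub_disp_le_of_close {ω : Circ} {b : Circ → ℝ} {g g' : ℝ → ℝ}
    (hg : IsMonoLift g) (hg' : IsMonoLift g') {N : ℕ} (hN : 0 < N) {δ C : ℝ} (hC0 : 0 ≤ C)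
    (hC : ∀ z, |disp (skew ω b g) 1 z| ≤ C) (hC' : ∀ z, |disp (skew ω b g') 1 z| ≤ C)
    (h : ∀ θ θ' : Circ, dist θ θ' < δ →
      |disp (skew ω b g) N (θ, 0) - disp (skew ω b g') N (θ', 0)| ≤ 1)
    (n : ℕ) {z z' : Circ × ℝ} (hz : dist z.1 z'.1 < δ) :
    |disp (skew ω b g) n z - disp (skew ω b g') n z'| ≤ 3 * (n / N) + 2 * N * C := by
  have h0 := abs_disp_sub_disp_mul_le hg hg' h (n / N) hz
  have hn : n = n / N * N + n % N := by rw [mul_comm]; exact (Nat.div_add_mod n N).symm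
  have h1 := abs_disp_le hC (n % N) ((skew ω b g)^[n / N * N] z)
  have h2 := abs_disp_le hC' (n % N) ((skew ω b g')^[n / N * N] z')
  have h3 : ((n % N : ℕ) : ℝ) * C ≤ N * C := by
    gcongr
    exact (Nat.mod_lt _ hN).le
  have h4 : ((n / N : ℕ) : ℝ) ≤ n / N := Nat.cast_div_le
  have e1 := disp_add (skew ω b g) (n / N * N) (n % N) z
  have e2 := disp_add (skew ω b g') (n / N * N) (n % N) z'
  rw [← hn] at e1 e2
  rw [e1, e2]
  rw [abs_le] at *
  constructor <;> linarith [h0.1, h0.2, h1.1, h1.2, h2.1, h2.2]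

theorem denseRange_nsmul {ω : ℝ} (hω : Irrational ω) :
    DenseRange (fun n : ℕ => n • (ω : Circ)) := by
  have : DenseRange (fun n : ℤ => n • (ω : Circ)) :=
    AddCircle.denseRange_zsmul_coe_iff.2 (by simpa using hω)
  exact denseRange_zsmul_iff_nsmul.1 this

/-- Finitely many steps of the rotation bring any point close to any other. -/
theorem exists_nsmul_close {ω : ℝ} (hω : Irrational ω) {δ : ℝ} (hδ : 0 < δ) :
    ∃ J : ℕ, ∀ θ θ' : Circ, ∃ j ≤ J, dist (θ + j • (ω : Circ)) θ' < δ := by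
  have hcov : (univ : Set Circ) ⊆ ⋃ j : ℕ, Metric.ball (j • (ω : Circ)) δ := by
    intro t _
    obtain ⟨j, hj⟩ := (denseRange_nsmul hω).exists_dist_lt t hδ
    exact mem_iUnion.2 ⟨j, hj⟩
  obtain ⟨s, hs⟩ := isCompact_univ.elim_finite_subcover _ (fun _ => Metric.isOpen_ball) hcov
  refine ⟨s.sup id, fun θ θ' => ?_⟩
  obtain ⟨j, hj, hd⟩ := mem_iUnion₂.1 (hs (mem_univ (θ' - θ)))
  refine ⟨j, Finset.le_sup (f := id) hj, ?_⟩
  rw [Metric.mem_ball, dist_comm] at hd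
  rwa [← dist_add_left θ, add_sub_cancel] at hd

theorem abs_disp_iterate_sub_le {F : Circ × ℝ → Circ × ℝ} {C : ℝ} (hC : ∀ z, |disp F 1 z| ≤ C)
    (n j : ℕ) (z : Circ × ℝ) : |disp F n (F^[j] z) - disp F n z| ≤ 2 * (j * C) := by
  have h1 := disp_add F j n z
  have h2 := disp_add F n j z
  rw [add_comm n j] at h2
  have h3 := abs_disp_le hC j z
  have h4 := abs_disp_le hC j (F^[n] z)
  rw [abs_le] at *
  constructor <;> linarith [h3.1, h3.2, h4.1, h4.2]

/-- Boundedly many rotation steps bring one base point near the other, at bounded cost; from then on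
the error grows with slope `3 / N`. -/
theorem eventually_disp_sub_disp_le {ω : ℝ} (hω : Irrational ω) {b : Circ → ℝ} {g : ℝ → ℝ}
    (hb : Continuous b) (hg : IsMonoLift g) {ε : ℝ} (hε : 0 < ε) :
    ∀ᶠ n : ℕ in atTop, ∀ z z' : Circ × ℝ,
      |disp (skew ω b g) n z - disp (skew ω b g) n z'| ≤ ε * n := by
  obtain ⟨C, hC0, hC⟩ := exists_abs_disp_le (ω := (ω : Circ)) hb hg
  -- This makes `3 / N < ε / 2`; the bounded terms are absorbed in the other half once `n` is large.
  obtain ⟨N, hN⟩ := exists_nat_gt (6 / ε)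
  have hN0 : (0 : ℝ) < N := lt_trans (by positivity) hN
  have hcont : Continuous (fun θ : Circ => disp (skew ω b g) N (θ, 0)) := by
    have := (continuous_iterate_skew (P := Unit) (ω := (ω : Circ)) (g := fun _ => g) hb
      (hg.cont.comp continuous_snd) N)
    have h2 : Continuous (fun θ : Circ => (((), (θ, 0)) : Unit × (Circ × ℝ))) := by fun_prop
    exact (continuous_snd.comp (this.comp h2)).sub continuous_const
  obtain ⟨δ, hδ, hδ'⟩ := Metric.uniformContinuous_iff.1
    (CompactSpace.uniformContinuous_of_continuous hcont) 1 one_pos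
  have h (θ θ' : Circ) (hd : dist θ θ' < δ) :
      |disp (skew ω b g) N (θ, 0) - disp (skew ω b g) N (θ', 0)| ≤ 1 := (hδ' hd).le
  obtain ⟨J, hJ⟩ := exists_nsmul_close hω hδ
  obtain ⟨n₀, hn₀⟩ := exists_nat_gt ((2 * (J * C) + 2 * N * C) / (ε / 2))
  filter_upwards [eventually_ge_atTop n₀] with n hn z z'
  obtain ⟨j, hj, hd⟩ := hJ z.1 z'.1
  have h1 := abs_disp_iterate_sub_le hC n j z
  have h2 := abs_disp_sub_disp_le_of_close hg hg (by exact_mod_cast hN0) hC0 hC hC h n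
    (z := (skew ω b g)^[j] z) (z' := z') (by rwa [iterate_skew_fst])
  have h3 : (j : ℝ) * C ≤ J * C := by gcongr
  have h4 : 2 * (J * C) + 2 * N * C ≤ ε / 2 * n := by
    rw [div_lt_iff₀ (by positivity)] at hn₀
    have : (n₀ : ℝ) ≤ n := by exact_mod_cast hn
    nlinarith
  have h5 : 3 * ((n : ℝ) / N) ≤ ε / 2 * n := by
    rw [div_lt_iff₀ hε] at hN
    rw [mul_div_assoc', div_le_iff₀ hN0]
    have : (0 : ℝ) ≤ n := by positivity
    nlinarith
  rw [abs_le] at *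
  constructor <;> linarith [h1.1, h1.2, h2.1, h2.2]

/-- The fibred rotation number of a monotone skew product over an irrational rotation. -/
theorem exists_rotation {ω : ℝ} (hω : Irrational ω) {b : Circ → ℝ} {g : ℝ → ℝ}
    (hb : Continuous b) (hg : IsMonoLift g) :
    ∃ ρ : ℝ, TendstoUniformly (avgDisp (skew ω b g)) (fun _ => ρ) atTop := by
  obtain ⟨C, hC0, hC⟩ := exists_abs_disp_le (ω := (ω : Circ)) hb hg
  set F := skew (ω : Circ) b g with hF
  have hbdd (n : ℕ) : BddAbove (range (disp F n)) :=
    ⟨n * C, by rintro _ ⟨z, rfl⟩; exact (le_abs_self _).trans (abs_disp_le hC n z)⟩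
  -- The fibrewise supremum is subadditive, so Fekete's lemma gives the limit; the previous lemma
  -- shows that every displacement is within `ε / 2 * n` of this supremum.
  let u : ℕ → ℝ := fun n => ⨆ z, disp F n z
  have hu (n : ℕ) (z) : disp F n z ≤ u n := le_ciSup (hbdd n) z
  have hsub : Subadditive u := fun m n => ciSup_le fun z => by
    rw [disp_add]
    exact add_le_add (hu _ _) (hu _ _)
  have hlow : BddBelow (range fun n : ℕ => u n / n) := by
    refine ⟨-C, ?_⟩
    rintro _ ⟨n, rfl⟩
    rcases Nat.eq_zero_or_pos n with rfl | hn
    · simpa using hC0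
    · have hn' : (0 : ℝ) < n := by exact_mod_cast hn
      rw [le_div_iff₀ hn']
      have h1 := hu n (0, 0)
      have h2 := (abs_le.1 (abs_disp_le hC n (0, 0))).1
      linarith
  refine ⟨hsub.lim, Metric.tendstoUniformly_iff.2 fun ε hε => ?_⟩
  have h1 := (Metric.tendsto_nhds.1 (hsub.tendsto_lim hlow)) (ε / 2) (half_pos hε)
  filter_upwards [h1, eventually_disp_sub_disp_le hω hb hg (half_pos hε),
    eventually_gt_atTop 0] with n h1 h2 hn z
  have hn' : (0 : ℝ) < n := by exact_mod_cast hn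
  have h3 : u n ≤ disp F n z + ε / 2 * n := ciSup_le fun w => by
    have := (abs_le.1 (h2 w z)).2
    linarith
  have h4 := hu n z
  have h5 : u n / n ≤ avgDisp F n z + ε / 2 := by
    rw [avgDisp_eq, div_add' _ _ _ hn'.ne']
    gcongr
  have h6 : avgDisp F n z ≤ u n / n := by
    rw [avgDisp_eq]
    gcongr
  rw [Real.dist_eq, abs_lt] at *
  constructor <;> linarith [h1.1, h1.2]

/-- The fibred rotation number depends continuously on a compact parameter. -/
theorem continuous_rotation {P : Type*} [PseudoMetricSpace P] [CompactSpace P] {ω : ℝ}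
    {b : Circ → ℝ} {g : P → ℝ → ℝ}
    (hb : Continuous b) (hg : ∀ p, IsMonoLift (g p))
    (hcont : Continuous (fun p : P × ℝ => g p.1 p.2)) {ρ : P → ℝ}
    (hρ : ∀ p, TendstoUniformly (avgDisp (skew ω b (g p))) (fun _ => ρ p) atTop) :
    Continuous ρ := by
  rw [Metric.continuous_iff]
  intro p ε hε
  obtain ⟨N, hN⟩ := exists_nat_gt (6 / ε)
  have hN0 : (0 : ℝ) < N := lt_trans (by positivity) hN
  have hc : Continuous (fun q : P × Circ => disp (skew ω b (g q.1)) N (q.2, 0)) := by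
    have h2 : Continuous (fun q : P × Circ => ((q.1, (q.2, 0)) : P × (Circ × ℝ))) := by fun_prop
    exact (continuous_snd.comp ((continuous_iterate_skew (ω := (ω : Circ)) hb hcont N).comp
      h2)).sub continuous_const
  obtain ⟨δ, hδ, hδ'⟩ := Metric.uniformContinuous_iff.1
    (CompactSpace.uniformContinuous_of_continuous hc) 1 one_pos
  refine ⟨δ, hδ, fun q hq => ?_⟩
  have h (θ θ' : Circ) (hd : dist θ θ' < δ) :
      |disp (skew ω b (g q)) N (θ, 0) - disp (skew ω b (g p)) N (θ', 0)| ≤ 1 :=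
    (hδ' (a := (q, θ)) (b := (p, θ')) (max_lt hq hd)).le
  -- These bounds may depend on `q`: their contribution is divided by `n` and disappears in the
  -- limit.
  obtain ⟨C₁, hC₁0, hC₁⟩ := exists_abs_disp_le (ω := (ω : Circ)) hb (hg q)
  obtain ⟨C₂, hC₂0, hC₂⟩ := exists_abs_disp_le (ω := (ω : Circ)) hb (hg p)
  have key (n : ℕ) := abs_disp_sub_disp_le_of_close (hg q) (hg p) (by exact_mod_cast hN0)
    (hC₁0.trans (le_max_left C₁ C₂)) (fun z => (hC₁ z).trans (le_max_left _ _))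
    (fun z => (hC₂ z).trans (le_max_right _ _)) h n (z := (0, 0)) (z' := (0, 0)) (by simpa)
  have hlim := ((hρ q).tendsto_at (0, 0)).sub ((hρ p).tendsto_at (0, 0))
  have hle : ∀ᶠ n : ℕ in atTop, |avgDisp (skew ω b (g q)) n (0, 0)
      - avgDisp (skew ω b (g p)) n (0, 0)| ≤ 3 / N + 2 * N * max C₁ C₂ / n := by
    filter_upwards [eventually_gt_atTop 0] with n hn
    have hn' : (0 : ℝ) < n := by exact_mod_cast hn
    rw [avgDisp_eq, avgDisp_eq, ← sub_div, abs_div, Nat.abs_cast, div_le_iff₀ hn']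
    refine (key n).trans (le_of_eq ?_)
    field_simp
  have hlim2 : Tendsto (fun n : ℕ => 3 / (N : ℝ) + 2 * N * max C₁ C₂ / n) atTop
      (𝓝 (3 / (N : ℝ) + 0)) :=
    tendsto_const_nhds.add (tendsto_const_div_atTop_nhds_zero_nat _)
  have := le_of_tendsto_of_tendsto hlim.abs hlim2 hle
  rw [Real.dist_eq]
  refine this.trans_lt ?_
  rw [add_zero, div_lt_iff₀ hN0]
  rw [div_lt_iff₀ hε] at hN
  linarith

/-! ### Running supremum and infimum. -/

/-- The running supremum `x ↦ sup_{y ≤ x} H y` of a degree one lift. -/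
def runSup (H : ℝ → ℝ) (x : ℝ) : ℝ := sSup ((fun t => H (x - t)) '' Icc 0 1)

/-- The running infimum `x ↦ inf_{y ≥ x} H y` of a degree one lift. -/
def runInf (H : ℝ → ℝ) (x : ℝ) : ℝ := -runSup (fun y => -H (-y)) (-x)

section

variable {H : ℝ → ℝ}

theorem exists_runSup_eq (hc : Continuous H) (x : ℝ) :
    ∃ t ∈ Icc (0 : ℝ) 1, runSup H x = H (x - t) := by
  obtain ⟨t, ht, h, -⟩ := isCompact_Icc.exists_sSup_image_eq_and_ge
    (nonempty_Icc.2 (zero_le_one (α := ℝ)))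
    (show ContinuousOn (fun t => H (x - t)) (Icc 0 1) from
      (hc.comp (continuous_const.sub continuous_id)).continuousOn)
  exact ⟨t, ht, h⟩

/-- A window of length one suffices: moving `y` up by a nonnegative integer into the window only
raises `H`. -/
theorem le_runSup (hc : Continuous H) (h1 : ∀ x, H (x + 1) = H x + 1) {x y : ℝ} (h : y ≤ x) :
    H y ≤ runSup H x := by
  have hb : BddAbove ((fun t => H (x - t)) '' Icc 0 1) :=
    isCompact_Icc.bddAbove_image (hc.comp (continuous_const.sub continuous_id)).continuousOn
  have h2 := le_csSup hb (mem_image_of_mem _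
    (⟨Int.fract_nonneg _, (Int.fract_lt_one _).le⟩ : Int.fract (x - y) ∈ Icc (0 : ℝ) 1))
  refine le_trans ?_ h2
  have h3 : x - Int.fract (x - y) = y + (⌊x - y⌋ : ℤ) := by
    rw [Int.fract]
    ring
  simp only [h3]
  rw [map_add_int h1]
  have : (0 : ℝ) ≤ (⌊x - y⌋ : ℤ) := by exact_mod_cast Int.floor_nonneg.2 (by linarith)
  linarith

theorem runSup_le (hc : Continuous H) {x c : ℝ} (h : ∀ y ≤ x, H y ≤ c) : runSup H x ≤ c := by
  obtain ⟨t, ht, h'⟩ := exists_runSup_eq hc x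
  rw [h']
  exact h _ (by linarith [ht.1])

theorem isMonoLift_runSup (hc : Continuous H) (h1 : ∀ x, H (x + 1) = H x + 1) :
    IsMonoLift (runSup H) where
  mono x y hxy := runSup_le hc fun _ hw => le_runSup hc h1 (hw.trans hxy)
  cont := isCompact_Icc.continuous_sSup (f := fun x t => H (x - t)) (by
    change Continuous (fun p : ℝ × ℝ => H (p.1 - p.2))
    fun_prop)
  add_one x := by
    apply le_antisymm
    · refine runSup_le hc fun y hy => ?_
      have := le_runSup hc h1 (show y - 1 ≤ x by linarith)
      have h2 := h1 (y - 1)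
      rw [sub_add_cancel] at h2
      linarith
    · obtain ⟨t, ht, h⟩ := exists_runSup_eq hc x
      rw [h, ← h1]
      exact le_runSup hc h1 (by linarith [ht.1])

/-- The supremum is attained strictly to the left of `x`, while near `x` the function stays below
it, so moving `x` slightly changes nothing. -/
theorem runSup_eventually_const (hc : Continuous H) (h1 : ∀ x, H (x + 1) = H x + 1) {x : ℝ}
    (h : H x < runSup H x) : ∀ᶠ y in 𝓝 x, runSup H y = runSup H x := by
  obtain ⟨t, ht, ht'⟩ := exists_runSup_eq hc x
  have ht0 : 0 < t := by
    rcases ht.1.eq_or_lt with h0 | h0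
    · rw [← h0, sub_zero] at ht'
      exact absurd ht' h.ne'
    · exact h0
  obtain ⟨η, hη, hη'⟩ := Metric.eventually_nhds_iff.1 ((hc.tendsto x).eventually (gt_mem_nhds h))
  filter_upwards [Metric.ball_mem_nhds x hη, Ioi_mem_nhds (show x - t < x by linarith)]
    with y hy hy'
  apply le_antisymm
  · refine runSup_le hc fun w hw => ?_
    rcases le_or_gt w x with hwx | hwx
    · exact le_runSup hc h1 hwx
    · refine (hη' ?_).le
      rw [Metric.mem_ball, Real.dist_eq, abs_lt] at hy
      rw [Real.dist_eq, abs_lt]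
      constructor <;> linarith [hy.2]
  · rw [ht']
    exact le_runSup hc h1 (le_of_lt hy')

theorem runSup_of_monotone (hc : Continuous H) (h1 : ∀ x, H (x + 1) = H x + 1) (hm : Monotone H) :
    runSup H = H :=
  funext fun _ => le_antisymm (runSup_le hc fun _ h => hm h) (le_runSup hc h1 le_rfl)

theorem continuous_reflect (hc : Continuous H) : Continuous (fun y => -H (-y)) := by fun_prop

theorem reflect_add_one (h1 : ∀ x, H (x + 1) = H x + 1) (x : ℝ) :
    (fun y => -H (-y)) (x + 1) = (fun y => -H (-y)) x + 1 := by
  have := h1 (-(x + 1))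
  rw [show -(x + 1) + 1 = -x by ring] at this
  simp only
  linarith

theorem runInf_le (hc : Continuous H) (h1 : ∀ x, H (x + 1) = H x + 1) {x y : ℝ} (h : x ≤ y) :
    runInf H x ≤ H y := by
  have := le_runSup (continuous_reflect hc) (reflect_add_one h1) (neg_le_neg h)
  simp only [neg_neg] at this
  rw [runInf]
  linarith

theorem le_runInf (hc : Continuous H) {x c : ℝ} (h : ∀ y, x ≤ y → c ≤ H y) : c ≤ runInf H x := by
  have := runSup_le (continuous_reflect hc) (x := -x) (c := -c)
    fun y hy => neg_le_neg (h _ (by linarith))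
  rw [runInf]
  linarith

theorem exists_runInf_eq (hc : Continuous H) (x : ℝ) :
    ∃ t ∈ Icc (0 : ℝ) 1, runInf H x = H (x + t) := by
  obtain ⟨t, ht, h⟩ := exists_runSup_eq (continuous_reflect hc) (-x)
  refine ⟨t, ht, ?_⟩
  rw [runInf, h, neg_neg]
  congr 1
  ring

theorem isMonoLift_runInf (hc : Continuous H) (h1 : ∀ x, H (x + 1) = H x + 1) :
    IsMonoLift (runInf H) where
  mono x y hxy := le_runInf hc fun _ hw => runInf_le hc h1 (hxy.trans hw)
  cont := ((isMonoLift_runSup (continuous_reflect hc) (reflect_add_one h1)).cont.comp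
    continuous_neg).neg
  add_one x := by
    have := (isMonoLift_runSup (continuous_reflect hc) (reflect_add_one h1)).add_one (-(x + 1))
    rw [show -(x + 1) + 1 = -x by ring] at this
    rw [runInf, runInf, this]
    ring

theorem runInf_eventually_const (hc : Continuous H) (h1 : ∀ x, H (x + 1) = H x + 1) {x : ℝ}
    (h : runInf H x < H x) : ∀ᶠ y in 𝓝 x, runInf H y = runInf H x := by
  have h2 := runSup_eventually_const (continuous_reflect hc) (reflect_add_one h1) (x := -x)
    (by simp only [neg_neg]; rw [runInf] at h; linarith)
  filter_upwards [(continuous_neg.tendsto x).eventually h2] with y hy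
  simp only [runInf, hy]

end

/-! ### The monotone family between the two extremes. -/

/-- A monotone family interpolating between the running infimum and the running supremum of `G`,
each member of which is locally constant wherever it differs from `G`. -/
def pour (G : ℝ → ℝ) (μ : ℝ) : ℝ → ℝ := runSup fun y => min (G y) (runInf G y + μ)

section

variable {G : ℝ → ℝ}

theorem continuous_pourBase (hc : Continuous G) (h1 : ∀ x, G (x + 1) = G x + 1) (μ : ℝ) :
    Continuous fun y => min (G y) (runInf G y + μ) := by
  have := (isMonoLift_runInf hc h1).cont
  fun_prop

theorem pourBase_add_one (hc : Continuous G) (h1 : ∀ x, G (x + 1) = G x + 1) (μ x : ℝ) :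
    (fun y => min (G y) (runInf G y + μ)) (x + 1) =
      (fun y => min (G y) (runInf G y + μ)) x + 1 := by
  simp only [h1, (isMonoLift_runInf hc h1).add_one]
  rw [← min_add_add_right]
  congr 1
  ring

theorem isMonoLift_pour (hc : Continuous G) (h1 : ∀ x, G (x + 1) = G x + 1) (μ : ℝ) :
    IsMonoLift (pour G μ) :=
  isMonoLift_runSup (continuous_pourBase hc h1 μ) (pourBase_add_one hc h1 μ)

theorem continuous_pour (hc : Continuous G) (h1 : ∀ x, G (x + 1) = G x + 1) :
    Continuous fun p : ℝ × ℝ => pour G p.1 p.2 :=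
  isCompact_Icc.continuous_sSup
    (f := fun (p : ℝ × ℝ) t => min (G (p.2 - t)) (runInf G (p.2 - t) + p.1)) (by
      have := (isMonoLift_runInf hc h1).cont
      change Continuous (fun q : (ℝ × ℝ) × ℝ =>
        min (G (q.1.2 - q.2)) (runInf G (q.1.2 - q.2) + q.1.1))
      fun_prop)

theorem pour_zero (hc : Continuous G) (h1 : ∀ x, G (x + 1) = G x + 1) :
    pour G 0 = runInf G := by
  have h : (fun y => min (G y) (runInf G y + 0)) = runInf G := by
    funext y
    rw [add_zero, min_eq_right (runInf_le hc h1 le_rfl)]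
  have hI := isMonoLift_runInf hc h1
  rw [pour, h, runSup_of_monotone hI.cont hI.add_one hI.mono]

theorem pour_of_le {R : ℝ} (hR : ∀ x, G x ≤ runInf G x + R) : pour G R = runSup G := by
  have h : (fun y => min (G y) (runInf G y + R)) = G := funext fun y => min_eq_left (hR y)
  rw [pour, h]

/-- Either the running supremum exceeds the capped function at `x`, and is locally constant there,
or the cap `runInf G + μ` is active at `x`. In the second case `runInf G x < G x` since `μ ≥ 0`, so
`runInf G`, the cap and hence the supremum are constant near `x`. -/
theorem pour_eventually_const (hc : Continuous G) (h1 : ∀ x, G (x + 1) = G x + 1) {μ : ℝ}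
    (hμ : 0 ≤ μ) {x : ℝ} (h : pour G μ x ≠ G x) : ∀ᶠ y in 𝓝 x, pour G μ y = pour G μ x := by
  have hc' := continuous_pourBase hc h1 μ
  have h1' := pourBase_add_one hc h1 μ
  rcases (le_runSup hc' h1' (le_refl x)).lt_or_eq with h2 | h2
  · exact runSup_eventually_const hc' h1' h2
  have h3 : min (G x) (runInf G x + μ) = pour G μ x := h2
  have h4 : runInf G x + μ < G x := by
    by_contra! hle
    rw [min_eq_left hle] at h3
    exact h h3.symm
  rw [min_eq_right h4.le] at h3
  have h5 : ∀ᶠ y in 𝓝 x, min (G y) (runInf G y + μ) = pour G μ x := by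
    filter_upwards [runInf_eventually_const hc h1 (show runInf G x < G x by linarith),
      (hc.tendsto x).eventually (lt_mem_nhds h4)] with y hy hy'
    rw [hy, min_eq_right (le_of_lt hy'), h3]
  obtain ⟨η, hη, hη'⟩ := Metric.eventually_nhds_iff.1 h5
  filter_upwards [Metric.ball_mem_nhds x hη] with y hy
  apply le_antisymm
  · refine runSup_le hc' fun w hw => ?_
    rcases le_or_gt w x with hwx | hwx
    · exact le_runSup hc' h1' hwx
    · refine (hη' ?_).le
      rw [Metric.mem_ball, Real.dist_eq, abs_lt] at hy
      rw [Real.dist_eq, abs_lt]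
      constructor <;> linarith [hy.2]
  · rw [← hη' hy]
    exact le_runSup hc' h1' le_rfl

end

/-! ### Orbits avoiding the plateaus. -/

/-- The open set where `g` is locally constant. -/
def plateau (g : ℝ → ℝ) : Set ℝ := {x | ∀ᶠ y in 𝓝 x, g y = g x}

theorem isOpen_plateau (g : ℝ → ℝ) : IsOpen (plateau g) := by
  rw [isOpen_iff_mem_nhds]
  intro x hx
  filter_upwards [eventually_eventually_nhds.2 hx, hx] with y hy hy'
  filter_upwards [hy] with w hw
  rw [hw, hy']

theorem add_int_mem_plateau {g : ℝ → ℝ} (hg : ∀ x, g (x + 1) = g x + 1) {x : ℝ}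
    (hx : x ∈ plateau g) (k : ℤ) : x + k ∈ plateau g := by
  have h : Tendsto (fun y : ℝ => y - k) (𝓝 (x + k)) (𝓝 x) := by
    have := (continuous_sub_right (k : ℝ)).tendsto (x + k)
    rwa [add_sub_cancel_right] at this
  change ∀ᶠ y in 𝓝 (x + k), g y = g (x + k)
  filter_upwards [h.eventually hx] with y hy
  rw [map_add_int hg, ← hy, ← map_add_int hg, sub_add_cancel]

/-- Points whose orbit under the skew product never meets the plateaus of the fibre map. -/
def avoidSet (ω : Circ) (b : Circ → ℝ) (g : ℝ → ℝ) : Set (Circ × ℝ) :=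
  {z | ∀ n, ((skew ω b g)^[n] z).2 ∉ plateau g}

section

variable {ω : Circ} {b : Circ → ℝ} {g : ℝ → ℝ}

theorem continuous_skew_iterate (hb : Continuous b) (hg : Continuous g) (n : ℕ) :
    Continuous (skew ω b g)^[n] :=
  (continuous_iterate_skew (P := Unit) (ω := ω) (g := fun _ => g) hb
    (hg.comp continuous_snd) n).comp (continuous_const.prodMk continuous_id : Continuous
      fun z : Circ × ℝ => ((), z))

theorem isClosed_avoidSet (hb : Continuous b) (hg : Continuous g) :
    IsClosed (avoidSet ω b g) := by
  have : avoidSet ω b g = ⋂ n : ℕ, (fun z => ((skew ω b g)^[n] z).2) ⁻¹' (plateau g)ᶜ := by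
    ext z
    simp [avoidSet]
  rw [this]
  exact isClosed_iInter fun n => (isOpen_plateau g).isClosed_compl.preimage
    (continuous_snd.comp (continuous_skew_iterate hb hg n))

theorem skew_mem_avoidSet {z : Circ × ℝ} (hz : z ∈ avoidSet ω b g) :
    skew ω b g z ∈ avoidSet ω b g := fun n => hz (n + 1)

theorem add_int_mem_avoidSet (hg : ∀ x, g (x + 1) = g x + 1) {θ : Circ} {x : ℝ}
    (hz : (θ, x) ∈ avoidSet ω b g) (k : ℤ) : (θ, x + k) ∈ avoidSet ω b g := by
  intro n hn
  rw [iterate_skew_add_int hg] at hn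
  have := add_int_mem_plateau hg hn (-k)
  push_cast at this
  rw [add_neg_cancel_right] at this
  exact hz n this

theorem iterate_eventually_const (hb : Continuous b) (hg : IsMonoLift g) (θ : Circ) {x : ℝ}
    {i n : ℕ} (hin : i < n) (hi : ((skew ω b g)^[i] (θ, x)).2 ∈ plateau g) :
    ∀ᶠ y in 𝓝 x, ((skew ω b g)^[n] (θ, y)).2 = ((skew ω b g)^[n] (θ, x)).2 := by
  have hc : Continuous fun y : ℝ => ((skew ω b g)^[i] (θ, y)).2 :=
    continuous_snd.comp ((continuous_skew_iterate hb hg.cont i).comp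
      (continuous_const.prodMk continuous_id))
  filter_upwards [(hc.tendsto x).eventually hi] with y hy
  obtain ⟨m, rfl⟩ := Nat.exists_eq_add_of_lt hin
  have h : (skew ω b g)^[i + 1] (θ, y) = (skew ω b g)^[i + 1] (θ, x) := by
    rw [Function.iterate_succ_apply', Function.iterate_succ_apply']
    simp only [skew, iterate_skew_fst]
    rw [hy]
  rw [show i + m + 1 = m + (i + 1) by ring, Function.iterate_add_apply, h,
    ← Function.iterate_add_apply]

/-- Otherwise the `n`-th iterate on the fibre would be locally constant on ℝ, hence constant, yet it
increases by 1 over each unit interval. -/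
theorem exists_avoid_finite (hb : Continuous b) (hg : IsMonoLift g) (θ : Circ) (n : ℕ) :
    ∃ x ∈ Icc (0 : ℝ) 1, ∀ i < n, ((skew ω b g)^[i] (θ, x)).2 ∉ plateau g := by
  by_contra! hcon
  have hloc : IsLocallyConstant fun x : ℝ => ((skew ω b g)^[n] (θ, x)).2 := by
    rw [IsLocallyConstant.iff_eventually_eq]
    intro x
    obtain ⟨i, hi, hx⟩ := hcon (Int.fract x) ⟨Int.fract_nonneg x, (Int.fract_lt_one x).le⟩
    refine iterate_eventually_const hb hg θ hi ?_
    have := add_int_mem_plateau hg.add_one hx ⌊x⌋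
    rwa [← iterate_skew_add_int hg.add_one, Int.fract_add_floor] at this
  have h1 := hloc.apply_eq_of_preconnectedSpace (0 + ((1 : ℤ) : ℝ)) 0
  simp only [iterate_skew_add_int hg.add_one] at h1
  norm_num at h1

theorem exists_mem_avoidSet (hb : Continuous b) (hg : IsMonoLift g) (θ : Circ) :
    ∃ x ∈ Icc (0 : ℝ) 1, (θ, x) ∈ avoidSet ω b g := by
  let t : ℕ → Set ℝ := fun n =>
    {x | x ∈ Icc (0 : ℝ) 1 ∧ ∀ i < n, ((skew ω b g)^[i] (θ, x)).2 ∉ plateau g}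
  have hcl (n : ℕ) : IsClosed (t n) := by
    have : t n = Icc 0 1 ∩ ⋂ i : ℕ, ⋂ _ : i < n,
        (fun x => ((skew ω b g)^[i] (θ, x)).2) ⁻¹' (plateau g)ᶜ := by
      ext x
      simp [t]
    rw [this]
    exact isClosed_Icc.inter (isClosed_iInter fun i => isClosed_iInter fun _ =>
      (isOpen_plateau g).isClosed_compl.preimage (continuous_snd.comp
        ((continuous_skew_iterate hb hg.cont i).comp (continuous_const.prodMk continuous_id))))
  obtain ⟨x, hx⟩ := IsCompact.nonempty_iInter_of_sequence_nonempty_isCompact_isClosed t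
    (fun n x hx => ⟨hx.1, fun i hi => hx.2 i (hi.trans n.lt_succ_self)⟩)
    (fun n => exists_avoid_finite hb hg θ n)
    (isCompact_Icc.of_isClosed_subset (hcl 0) fun x hx => hx.1) hcl
  rw [mem_iInter] at hx
  exact ⟨x, (hx 0).1, fun n => (hx (n + 1)).2 n n.lt_succ_self⟩

end

/-! ### Minimal sets inside the avoiding set. -/

theorem exists_isMinimalSet_subset {X : Type*} [TopologicalSpace X] [CompactSpace X] {f : X → X}
    {K : Set X} (hne : K.Nonempty) (hcl : IsClosed K) (hK : MapsTo f K K) :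
    ∃ M ⊆ K, IsMinimalSet f M := by
  obtain ⟨M, hMK, hM⟩ := zorn_superset_nonempty
    {N : Set X | N.Nonempty ∧ IsClosed N ∧ MapsTo f N N} (by
      intro c hc hchain hcne
      refine ⟨⋂₀ c, ⟨?_, isClosed_sInter fun s hs => (hc hs).2.1, ?_⟩,
        fun s hs => sInter_subset_of_mem hs⟩
      · have := hcne.to_subtype
        rw [sInter_eq_iInter]
        refine IsCompact.nonempty_iInter_of_directed_nonempty_isCompact_isClosed _ ?_
          (fun s => (hc s.2).1) (fun s => (hc s.2).2.1.isCompact) (fun s => (hc s.2).2.1)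
        intro s t
        rcases hchain.total s.2 t.2 with h | h
        · exact ⟨s, Subset.rfl, h⟩
        · exact ⟨t, h, Subset.rfl⟩
      · exact fun x hx s hs => (hc hs).2.2 (hx s hs)) K ⟨hne, hcl, hK⟩
  exact ⟨M, hMK, hM.prop.1, hM.prop.2.1, hM.prop.2.2, fun N hN h1 h2 h3 =>
    hN.antisymm (hM.le_of_le ⟨h1, h2, h3⟩ hN)⟩

theorem continuous_proj : Continuous proj :=
  continuous_fst.prodMk ((AddCircle.continuous_mk' 1).comp continuous_snd)

theorem exists_int_of_proj_eq {z w : Circ × ℝ} (h : proj z = proj w) :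
    ∃ k : ℤ, z = (w.1, w.2 + k) := by
  have h1 : z.1 = w.1 := (Prod.ext_iff.1 h).1
  have h2 : (z.2 : Circ) = w.2 := (Prod.ext_iff.1 h).2
  have h3 : ((z.2 - w.2 : ℝ) : Circ) = 0 := by rw [AddCircle.coe_sub, h2, sub_self]
  obtain ⟨k, hk⟩ := (AddCircle.coe_eq_zero_iff 1).1 h3
  refine ⟨k, Prod.ext h1 ?_⟩
  simp only [zsmul_eq_mul, mul_one] at hk
  simp only [hk]
  ring

theorem coe_add_int (x : ℝ) (k : ℤ) : ((x + k : ℝ) : Circ) = x := by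
  have : ((k : ℝ) : Circ) = 0 := (AddCircle.coe_eq_zero_iff 1).2 ⟨k, by simp⟩
  rw [AddCircle.coe_add, this, add_zero]

theorem exists_proj_eq (w : Circ × Circ) : ∃ x ∈ Ico (0 : ℝ) 1, proj (w.1, x) = w := by
  obtain ⟨x, hx, h⟩ := AddCircle.eq_coe_Ico w.2
  exact ⟨x, hx, Prod.ext rfl h⟩

/-- A map that agrees with the projected skew product off the plateaus has a minimal set whose
orbits avoid the plateaus. -/
theorem exists_isMinimalSet_avoiding {ω : Circ} {b : Circ → ℝ} {g : ℝ → ℝ} (hb : Continuous b)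
    (hg : IsMonoLift g) {f : Circ × Circ → Circ × Circ}
    (hf : ∀ z ∈ avoidSet ω b g, f (proj z) = proj (skew ω b g z)) :
    ∃ M, IsMinimalSet f M ∧ proj ⁻¹' M ⊆ avoidSet ω b g := by
  have hsat {z : Circ × ℝ} (hz : proj z ∈ proj '' avoidSet ω b g) : z ∈ avoidSet ω b g := by
    obtain ⟨w, hw, hwz⟩ := hz
    obtain ⟨k, rfl⟩ := exists_int_of_proj_eq hwz.symm
    exact add_int_mem_avoidSet hg.add_one hw k
  -- Integer invariance allows restriction to a compact fundamental domain, so the image is closed.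
  have hK : proj '' avoidSet ω b g =
      proj '' (avoidSet ω b g ∩ univ ×ˢ Icc 0 1) := by
    refine Subset.antisymm ?_ (image_mono inter_subset_left)
    intro w hw
    obtain ⟨x, hx, h⟩ := exists_proj_eq w
    exact ⟨_, ⟨hsat (h.symm ▸ hw), mem_univ _, hx.1, hx.2.le⟩, h⟩
  obtain ⟨x, hx, hx'⟩ := exists_mem_avoidSet (ω := ω) hb hg 0
  obtain ⟨M, hMK, hM⟩ := exists_isMinimalSet_subset (f := f) (K := proj '' avoidSet ω b g)
    ⟨_, mem_image_of_mem _ hx'⟩ (by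
      rw [hK]
      exact (((isCompact_univ.prod isCompact_Icc).inter_left
        (isClosed_avoidSet hb hg.cont)).image continuous_proj).isClosed) (by
      rintro _ ⟨z, hz, rfl⟩
      exact ⟨_, skew_mem_avoidSet hz, (hf z hz).symm⟩)
  exact ⟨M, hM, fun z hz => hsat (hMK hz)⟩

/-! ### Zero entropy by counting itineraries. -/

section

variable {ω : Circ} {b : Circ → ℝ} {g : ℝ → ℝ}

theorem iterate_proj {f : Circ × Circ → Circ × Circ} {F : Circ × ℝ → Circ × ℝ}
    {M : Set (Circ × Circ)} (hM : MapsTo f M M)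
    (hf : ∀ z, proj z ∈ M → f (proj z) = proj (F z)) (n : ℕ) {z : Circ × ℝ} (hz : proj z ∈ M) :
    f^[n] (proj z) = proj (F^[n] z) := by
  induction n with
  | zero => rfl
  | succ n ih =>
    have h : proj (F^[n] z) ∈ M := ih ▸ hM.iterate n hz
    rw [Function.iterate_succ_apply', ih, hf _ h, Function.iterate_succ_apply']

/-- A single integer recording the itinerary of length `N` of a point of a fibre with respect to
the partition into intervals of length `1 / L`. -/
def itin (F : Circ × ℝ → Circ × ℝ) (N L : ℕ) (θ : Circ) (x : ℝ) : ℤ :=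
  ∑ i ∈ Finset.range N, (⌊(L : ℝ) * (F^[i] (θ, x)).2⌋ - ⌊(L : ℝ) * (F^[i] (θ, 0)).2⌋)

theorem itin_term_mono (hg : Monotone g) (L : ℕ) (θ : Circ) {x y : ℝ} (h : x ≤ y) (i : ℕ) :
    ⌊(L : ℝ) * ((skew ω b g)^[i] (θ, x)).2⌋ ≤ ⌊(L : ℝ) * ((skew ω b g)^[i] (θ, y)).2⌋ :=
  Int.floor_le_floor (mul_le_mul_of_nonneg_left (iterate_skew_mono hg i θ h) (by positivity))

theorem itin_nonneg (hg : Monotone g) (N L : ℕ) (θ : Circ) {x : ℝ} (hx : 0 ≤ x) :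
    0 ≤ itin (skew ω b g) N L θ x :=
  Finset.sum_nonneg fun i _ => sub_nonneg.2 (itin_term_mono hg L θ hx i)

theorem itin_le (hg : IsMonoLift g) (N L : ℕ) (θ : Circ) {x : ℝ} (hx : x ≤ 1) :
    itin (skew ω b g) N L θ x ≤ N * L := by
  have h (i : ℕ) (_ : i ∈ Finset.range N) :
      ⌊(L : ℝ) * ((skew ω b g)^[i] (θ, x)).2⌋ - ⌊(L : ℝ) * ((skew ω b g)^[i] (θ, 0)).2⌋
        ≤ (L : ℤ) := by
    have h1 := itin_term_mono (ω := ω) (b := b) hg.mono L θ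
      (show x ≤ 0 + ((1 : ℤ) : ℝ) by simpa) i
    rw [iterate_skew_add_int hg.add_one, mul_add, Int.cast_one, mul_one,
      Int.floor_add_natCast] at h1
    linarith
  refine (Finset.sum_le_sum h).trans ?_
  simp

/-- Every summand of `itin` is monotone in the point, so equal sums force equal summands: one
integer determines the whole itinerary. -/
theorem abs_sub_lt_of_itin_eq (hg : Monotone g) {N L : ℕ} (hL : 0 < L) (θ : Circ) {x y : ℝ}
    (h : itin (skew ω b g) N L θ x = itin (skew ω b g) N L θ y) {i : ℕ} (hi : i < N) :
    |((skew ω b g)^[i] (θ, x)).2 - ((skew ω b g)^[i] (θ, y)).2| < 1 / L := by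
  wlog hxy : x ≤ y generalizing x y
  · rw [abs_sub_comm]
    exact this h.symm (not_le.1 hxy).le
  have h1 := (Finset.sum_eq_sum_iff_of_le fun i _ =>
    sub_le_sub_right (itin_term_mono (ω := ω) (b := b) hg L θ hxy i) _).1 h i
    (Finset.mem_range.2 hi)
  have h2 : ⌊(L : ℝ) * ((skew ω b g)^[i] (θ, x)).2⌋ =
    ⌊(L : ℝ) * ((skew ω b g)^[i] (θ, y)).2⌋ := by linarith
  have h3 := Int.abs_sub_lt_one_of_floor_eq_floor h2
  have hL' : (0 : ℝ) < L := by exact_mod_cast hL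
  rw [← mul_sub, abs_mul, abs_of_pos hL'] at h3
  rwa [lt_div_iff₀ hL', mul_comm]

theorem exists_close_iterates (hb : Continuous b) (hg : Continuous g) (N : ℕ) {ε : ℝ}
    (hε : 0 < ε) : ∃ δ > 0, ∀ θ θ' : Circ, dist θ θ' < δ → ∀ i < N, ∀ x ∈ Icc (0 : ℝ) 1,
      |((skew ω b g)^[i] (θ, x)).2 - ((skew ω b g)^[i] (θ', x)).2| < ε := by
  have hc : Continuous fun (p : Circ × Icc (0 : ℝ) 1) (i : Fin N) =>
      ((skew ω b g)^[i] (p.1, (p.2 : ℝ))).2 :=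
    continuous_pi fun i => continuous_snd.comp
      ((continuous_skew_iterate hb hg i).comp (by fun_prop))
  obtain ⟨δ, hδ, h⟩ := Metric.uniformContinuous_iff.1
    (CompactSpace.uniformContinuous_of_continuous hc) ε hε
  refine ⟨δ, hδ, fun θ θ' hd i hi x hx => ?_⟩
  have := h (a := (θ, ⟨x, hx⟩)) (b := (θ', ⟨x, hx⟩)) (by
    rw [Prod.dist_eq]
    exact max_lt hd (by simpa using hδ))
  exact (dist_le_pi_dist _ _ (⟨i, hi⟩ : Fin N)).trans_lt this

theorem dist_coe_le (x y : ℝ) : dist (x : Circ) (y : Circ) ≤ |x - y| := by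
  rw [dist_eq_norm, ← AddCircle.coe_sub, UnitAddCircle.norm_eq]
  simpa using round_le (x - y) 0

theorem proj_iterate_fract (hg : ∀ x, g (x + 1) = g x + 1) (i : ℕ) (w : Circ × ℝ) :
    proj ((skew ω b g)^[i] w) = proj ((skew ω b g)^[i] (w.1, Int.fract w.2)) := by
  have h := iterate_skew_add_int (ω := ω) (b := b) hg i w.1 (Int.fract w.2) ⌊w.2⌋
  rw [Int.fract_add_floor] at h
  refine Prod.ext ?_ ?_
  · simp only [proj, iterate_skew_fst]
  · simp only [proj]
    rw [← Prod.mk.eta (p := w), h, coe_add_int]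

/-- Points over the same base interval with the same itineraries stay close. -/
theorem dist_iterate_lt_of_itin_eq (hg : IsMonoLift g) {N L : ℕ} (hL : 0 < L) {δ ε : ℝ}
    (hδε : 2 * δ ≤ ε) (hLε : 3 / L ≤ ε)
    (hδ : ∀ θ θ' : Circ, dist θ θ' < δ → ∀ i < N, ∀ x ∈ Icc (0 : ℝ) 1,
      |((skew ω b g)^[i] (θ, x)).2 - ((skew ω b g)^[i] (θ', x)).2| < 1 / L)
    {c : Circ} {z z' : Circ × ℝ} (hz : dist z.1 c < δ) (hz' : dist z'.1 c < δ) {k : ℕ}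
    (h : ∀ m < k, itin (skew ω b g) N L (c + (N * m) • ω) (Int.fract ((skew ω b g)^[N * m] z).2)
      = itin (skew ω b g) N L (c + (N * m) • ω) (Int.fract ((skew ω b g)^[N * m] z').2))
    {n : ℕ} (hn : n < N * k) :
    dist (proj ((skew ω b g)^[n] z)) (proj ((skew ω b g)^[n] z')) < ε := by
  have hN : 0 < N := Nat.pos_of_ne_zero (by rintro rfl; simp at hn)
  have hm : n / N < k := Nat.div_lt_of_lt_mul hn
  have hi : n % N < N := Nat.mod_lt _ hN
  have hn' : n = n % N + N * (n / N) := (Nat.mod_add_div n N).symm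
  set m := n / N
  set i := n % N
  rw [hn', Function.iterate_add_apply, Function.iterate_add_apply,
    proj_iterate_fract hg.add_one, proj_iterate_fract hg.add_one i ((skew ω b g)^[N * m] z')]
  set w := (skew ω b g)^[N * m] z with hw
  set w' := (skew ω b g)^[N * m] z' with hw'
  have h1 : dist w.1 (c + (N * m) • ω) < δ := by rwa [hw, iterate_skew_fst, dist_add_right]
  have h1' : dist w'.1 (c + (N * m) • ω) < δ := by rwa [hw', iterate_skew_fst, dist_add_right]
  have hfr (y : ℝ) : Int.fract y ∈ Icc (0 : ℝ) 1 := ⟨Int.fract_nonneg y, (Int.fract_lt_one y).le⟩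
  have h2 := hδ _ _ h1 i hi _ (hfr w.2)
  have h2' := hδ _ _ h1' i hi _ (hfr w'.2)
  have h3 := abs_sub_lt_of_itin_eq hg.mono hL _ (h m hm) hi
  rw [Prod.dist_eq]
  refine max_lt ?_ ?_
  · simp only [proj, iterate_skew_fst]
    rw [dist_add_right]
    linarith [dist_triangle_right w.1 w'.1 (c + (N * m) • ω)]
  · refine (dist_coe_le _ _).trans_lt (lt_of_lt_of_le ?_ hLε)
    have : (3 : ℝ) / L = 1 / L + 1 / L + 1 / L := by ring
    rw [this]
    rw [abs_lt] at *
    constructor <;> linarith [h2.1, h2.2, h2'.1, h2'.2, h3.1, h3.2]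

/-- Code a point by a ball of a finite cover of the base and one `itin` value per block of length
`N`, computed in the fibre over the moving centre of that ball. Each value lies between 0 and `N *
L`, and points with equal codes stay `ε`-close. -/
theorem exists_netMaxcard_le (hb : Continuous b) (hg : IsMonoLift g)
    {f : Circ × Circ → Circ × Circ} {M : Set (Circ × Circ)} (hM : MapsTo f M M)
    (hf : ∀ z, proj z ∈ M → f (proj z) = proj (skew ω b g z)) {N L : ℕ} (hL : 0 < L) {ε : ℝ}
    (hε : 0 < ε) (hLε : 3 / L ≤ ε) :
    ∃ A : ℕ, ∀ k : ℕ, Dynamics.netMaxcard f M {p | dist p.1 p.2 < ε} (N * k) ≤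
      ((A * (N * L + 1) ^ k : ℕ) : ℕ∞) := by
  obtain ⟨δ₀, hδ₀, hδ₀'⟩ := exists_close_iterates (ω := ω) hb hg.cont N
    (show (0 : ℝ) < 1 / L by positivity)
  obtain ⟨δ, hδ, hδδ₀, hδε⟩ : ∃ δ > 0, δ ≤ δ₀ ∧ 2 * δ ≤ ε :=
    ⟨min δ₀ (ε / 2), by positivity, min_le_left _ _, by linarith [min_le_right δ₀ (ε / 2)]⟩
  have hclose (θ θ' : Circ) (hd : dist θ θ' < δ) := hδ₀' θ θ' (hd.trans_le hδδ₀)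
  obtain ⟨J, -, hJ⟩ := isCompact_univ.elim_nhds_subcover (fun c : Circ => Metric.ball c δ)
    (fun c _ => Metric.ball_mem_nhds c hδ)
  have hJ' (θ : Circ) : ∃ c ∈ J, dist θ c < δ := by
    simpa using hJ (mem_univ θ)
  choose c hcJ hc using hJ'
  choose x hx hxw using exists_proj_eq
  refine ⟨J.card, fun k => iSup₂_le fun s hs => ?_⟩
  let code : Circ × Circ → Circ × (Fin k → Fin (N * L + 1)) := fun w =>
    (c w.1, fun m => Fin.ofNat _ (itin (skew ω b g) N L (c w.1 + (N * (m : ℕ)) • ω)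
      (Int.fract ((skew ω b g)^[N * m] (w.1, x w)).2)).toNat)
  have hinj : Set.InjOn code s := by
    intro w hw w' hw' h
    have h1 : c w.1 = c w'.1 := (Prod.ext_iff.1 h).1
    by_contra hne
    -- Distinct points of a net have disjoint dynamical balls; equal codes would put `w'` in both.
    have hdis := Set.disjoint_left.1 (hs.2 hw hw' hne)
    refine hdis (a := w') ?_ ?_
    · rw [Dynamics.mem_ball_dynEntourage]
      intro n hn
      have e1 := iterate_proj hM hf n (z := (w.1, x w)) (by rw [hxw]; exact hs.1 hw)
      have e2 := iterate_proj hM hf n (z := (w'.1, x w')) (by rw [hxw]; exact hs.1 hw')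
      rw [hxw] at e1 e2
      change dist (f^[n] w) (f^[n] w') < ε
      rw [e1, e2]
      have hc' : dist w'.1 (c w.1) < δ := h1 ▸ hc w'.1
      refine dist_iterate_lt_of_itin_eq hg hL hδε hLε hclose (z := (w.1, x w))
        (z' := (w'.1, x w')) (hc w.1) hc' (fun m hm => ?_) hn
      have h2 := congrFun (Prod.ext_iff.1 h).2 ⟨m, hm⟩
      have h3 := congrArg Fin.val h2
      simp only [code, Fin.val_ofNat] at h3
      have hlt (θ : Circ) (y : ℝ) :
          (itin (skew ω b g) N L θ (Int.fract y)).toNat < N * L + 1 := by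
        have := itin_le (ω := ω) (b := b) hg N L θ (Int.fract_lt_one y).le
        have h0 := itin_nonneg (ω := ω) (b := b) hg.mono N L θ (Int.fract_nonneg y)
        zify
        rw [Int.toNat_of_nonneg h0]
        linarith
      rw [Nat.mod_eq_of_lt (hlt _ _), Nat.mod_eq_of_lt (hlt _ _), ← h1] at h3
      have h4 (y : ℝ) := itin_nonneg (ω := ω) (b := b) hg.mono N L (c w.1 + (N * m) • ω)
        (Int.fract_nonneg y)
      rw [← Int.toNat_of_nonneg (h4 _), h3, Int.toNat_of_nonneg (h4 _)]
    · rw [Dynamics.mem_ball_dynEntourage]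
      intro n _
      change dist (f^[n] w') (f^[n] w') < ε
      rwa [dist_self]
  have hcard := Finset.card_le_card_of_injOn (t := J ×ˢ Finset.univ) code
    (fun w _ => by simp [code, hcJ]) hinj
  rw [Finset.card_product, Finset.card_univ, Fintype.card_fun, Fintype.card_fin,
    Fintype.card_fin] at hcard
  exact_mod_cast hcard

/-- Sets on which the dynamics is that of a monotone skew product have zero entropy. -/
theorem zeroEntropyOn_of_skew (hb : Continuous b) (hg : IsMonoLift g)
    {f : Circ × Circ → Circ × Circ} {M : Set (Circ × Circ)} (hne : M.Nonempty)
    (hM : MapsTo f M M) (hf : ∀ z, proj z ∈ M → f (proj z) = proj (skew ω b g z)) :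
    ZeroEntropyOn f M := by
  refine ⟨hM, ?_⟩
  rw [Dynamics.coverEntropy_restrict]
  refine le_antisymm ?_ (Dynamics.coverEntropy_nonneg f hne)
  rw [Dynamics.coverEntropy_eq_iSup_basis_netEntropyEntourage Metric.uniformity_basis_dist]
  refine iSup₂_le fun ε hε => ?_
  obtain ⟨L, hL⟩ := exists_nat_gt (3 / ε)
  have hL0 : (0 : ℝ) < L := lt_trans (by positivity) hL
  have hLε : 3 / (L : ℝ) ≤ ε := by
    rw [div_lt_iff₀ hε] at hL
    rw [div_le_iff₀ hL0]
    linarith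
  set E := Dynamics.netEntropyEntourage f M {p | dist p.1 p.2 < ε} with hE
  have hmul (N : ℕ) (hN : N ≠ 0) : (N : EReal) * E ≤ ENNReal.log ((N * L + 1 : ℕ) : ENNReal) := by
    obtain ⟨A, hA⟩ := exists_netMaxcard_le hb hg hM hf (N := N) (by exact_mod_cast hL0) hε hLε
    have hmono : Monotone fun n : ℕ =>
        ((Dynamics.netMaxcard f M {p | dist p.1 p.2 < ε} n : ℕ∞) : ENNReal) :=
      fun m n hmn => ENat.toENNReal_mono (Dynamics.netMaxcard_monotone_time f M _ hmn)
    rw [hE, Dynamics.netEntropyEntourage, ← hmono.expGrowthSup_comp_mul hN,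
      ← ExpGrowth.expGrowthSup_pow]
    refine ExpGrowth.expGrowthSup_le_of_eventually_le (b := (A : ENNReal)) (by simp)
      (Eventually.of_forall fun k => ?_)
    have := ENat.toENNReal_mono (hA k)
    simpa using this
  by_contra! hpos
  obtain ⟨r, hr0, hrE⟩ := EReal.lt_iff_exists_real_btwn.1 hpos
  have hr : 0 < r := by exact_mod_cast hr0
  -- Chosen so that the quadratic term `(N r)² / 2` of the exponential exceeds `N * L`.
  obtain ⟨N, hN⟩ := exists_nat_gt (2 * L / r ^ 2)
  have hN0 : (0 : ℝ) < N := lt_of_le_of_lt (by positivity) hN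
  have h1 : ((N * r : ℝ) : EReal) ≤ ENNReal.log ((N * L + 1 : ℕ) : ENNReal) := by
    refine le_trans ?_ (hmul N (by rintro rfl; simp at hN0))
    push_cast
    exact mul_le_mul_of_nonneg_left hrE.le (by positivity)
  have h2 : (N : ℝ) * r ≤ Real.log (N * L + 1) := by
    have h3 : ENNReal.log ((N * L + 1 : ℕ) : ENNReal) = ((Real.log (N * L + 1) : ℝ) : EReal) := by
      rw [ENNReal.log_pos_real (by simp) (ENNReal.natCast_ne_top _), ENNReal.toReal_natCast]
      push_cast
      rfl
    rw [h3] at h1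
    exact_mod_cast h1
  have h4 : Real.exp (N * r) ≤ N * L + 1 := by
    rwa [← Real.le_log_iff_exp_le (by positivity)]
  have h5 := Real.quadratic_le_exp_of_nonneg (show 0 ≤ N * r by positivity)
  rw [div_lt_iff₀ (by positivity)] at hN
  have h6 : (N : ℝ) * (2 * L) < N * (N * r ^ 2) := by gcongr
  nlinarith [mul_pos hN0 hr]

end

/-! ### Projections of minimal sets to the base. -/

theorem IsMinimalSet.fst_image_eq_univ {ω : ℝ} (hω : Irrational ω) {f : Circ × Circ → Circ × Circ}
    (hf : ∀ w, (f w).1 = w.1 + (ω : Circ)) {M : Set (Circ × Circ)} (hM : IsMinimalSet f M) :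
    Prod.fst '' M = univ := by
  have hcl : IsClosed (Prod.fst '' M) := (hM.isClosed.isCompact.image continuous_fst).isClosed
  obtain ⟨w, hw⟩ := hM.nonempty
  have hit (n : ℕ) : (f^[n] w).1 = w.1 + n • (ω : Circ) := by
    induction n with
    | zero => simp
    | succ n ih => rw [Function.iterate_succ_apply', hf, ih, succ_nsmul, add_assoc]
  have hd : DenseRange fun n : ℕ => w.1 + n • (ω : Circ) :=
    (Homeomorph.addLeft w.1).surjective.denseRange.comp (denseRange_nsmul hω)
      (Homeomorph.addLeft w.1).continuous
  rw [← hcl.closure_eq]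
  refine (hd.mono ?_).closure_eq
  rintro _ ⟨n, rfl⟩
  exact ⟨f^[n] w, hM.mapsTo.iterate n hw, hit n⟩

/-- Relatively open pieces of minimal sets have projections with non-empty interior. -/
theorem IsMinimalSet.dispersed {ω : ℝ} (hω : Irrational ω) {f : Circ × Circ → Circ × Circ}
    (hfc : Continuous f) (hf : ∀ w, (f w).1 = w.1 + (ω : Circ)) {M : Set (Circ × Circ)}
    (hM : IsMinimalSet f M) {z : Circ × Circ} (hz : z ∈ M) {U : Set (Circ × Circ)}
    (hU : IsOpen U) (hzU : z ∈ U) :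
    ∃ a b : ℝ, a < b ∧ (fun t : ℝ => (t : Circ)) '' Ioo a b ⊆ Prod.fst '' (U ∩ M) := by
  obtain ⟨V, hV, hVcl, hVU⟩ := exists_mem_nhds_isClosed_subset (hU.mem_nhds hzU)
  obtain ⟨O, hOV, hO, hzO⟩ := mem_nhds_iff.1 hV
  -- The points of `M` that never enter `O` form a closed invariant set missing `z`, which
  -- minimality makes empty.
  have hvisit (w : Circ × Circ) (hw : w ∈ M) : ∃ n : ℕ, f^[n] w ∈ O := by
    by_contra! hcon
    have := hM.eq_of_subset (M ∩ ⋂ n : ℕ, f^[n] ⁻¹' Oᶜ) inter_subset_left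
      ⟨w, hw, mem_iInter.2 hcon⟩
      (hM.isClosed.inter (isClosed_iInter fun n => hO.isClosed_compl.preimage (hfc.iterate n)))
      (fun v hv => ⟨hM.mapsTo hv.1, mem_iInter.2 fun n => mem_iInter.1 hv.2 (n + 1)⟩)
    rw [← this] at hz
    exact mem_iInter.1 hz.2 0 hzO
  have hit (n : ℕ) (w : Circ × Circ) : (f^[n] w).1 = w.1 + n • (ω : Circ) := by
    induction n with
    | zero => simp
    | succ n ih => rw [Function.iterate_succ_apply', hf, ih, succ_nsmul, add_assoc]
  set A := Prod.fst '' (V ∩ M) with hA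
  have hAcl : IsClosed A := ((hVcl.inter hM.isClosed).isCompact.image continuous_fst).isClosed
  -- Baire: countably many rotated copies of the closed set `A` cover the circle, so one of them has
  -- interior.
  obtain ⟨n, hn⟩ := nonempty_interior_of_iUnion_of_closed
    (f := fun n : ℕ => Homeomorph.addRight (n • (ω : Circ)) ⁻¹' A)
    (fun n => hAcl.preimage (Homeomorph.continuous _)) (by
      refine eq_univ_of_forall fun θ => ?_
      obtain ⟨w, hw, rfl⟩ := (hM.fst_image_eq_univ hω hf).symm ▸ mem_univ θ
      obtain ⟨n, hn⟩ := hvisit w hw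
      exact mem_iUnion.2 ⟨n, f^[n] w, ⟨hOV hn, hM.mapsTo.iterate n hw⟩, hit n w⟩)
  rw [← Homeomorph.preimage_interior] at hn
  obtain ⟨θ, hθ⟩ := hn
  have hop : IsOpen ((fun t : ℝ => (t : Circ)) ⁻¹' interior A) :=
    isOpen_interior.preimage (AddCircle.continuous_mk' 1)
  obtain ⟨t, ht⟩ := QuotientAddGroup.mk_surjective (Homeomorph.addRight (n • (ω : Circ)) θ)
  obtain ⟨a, b, hab, hsub⟩ := hop.exists_Ioo_subset ⟨t, by
    change (t : Circ) ∈ interior A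
    exact ht.symm ▸ hθ⟩
  refine ⟨a, b, hab, ?_⟩
  rintro _ ⟨s, hs, rfl⟩
  obtain ⟨w, hw, hw'⟩ := interior_subset (hsub hs)
  exact ⟨w, ⟨hVU hw.1, hw.2⟩, hw'⟩

/-! ### Connected components of minimal sets. -/

theorem exists_isClopen_between {Y : Type*} [TopologicalSpace Y] [CompactSpace Y] [T2Space Y]
    {y : Y} {O : Set Y} (hO : IsOpen O) (h : connectedComponent y ⊆ O) :
    ∃ W : Set Y, IsClopen W ∧ y ∈ W ∧ W ⊆ O := by
  have : Nonempty {s : Set Y // IsClopen s ∧ y ∈ s} := ⟨⟨univ, isClopen_univ, mem_univ y⟩⟩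
  obtain ⟨⟨W, hW, hyW⟩, hWO⟩ := exists_subset_nhds_of_isCompact
    (V := fun s : {s : Set Y // IsClopen s ∧ y ∈ s} => (s : Set Y))
    (fun s t => ⟨⟨s ∩ t, s.2.1.inter t.2.1, s.2.2, t.2.2⟩, inter_subset_left, inter_subset_right⟩)
    (fun s => s.2.1.isClosed.isCompact)
    (U := O) (fun x hx => hO.mem_nhds (h (by rwa [connectedComponent_eq_iInter_isClopen])))
  exact ⟨W, hW, hyW, hWO⟩

/-- A section of the covering `ℝ → 𝕋` that is continuous away from one point. -/
theorem exists_section (a : ℝ) : ∃ s : Circ → ℝ, (∀ x, (s x : Circ) = x) ∧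
    (∀ x, s x ∈ Ico a (a + 1)) ∧ ∀ x ≠ (a : Circ), ContinuousAt s x :=
  ⟨fun x => AddCircle.equivIco 1 a x, fun _ => AddCircle.coe_equivIco,
    fun x => (AddCircle.equivIco 1 a x).2, fun _ hx =>
      continuous_subtype_val.continuousAt.comp (AddCircle.continuousAt_equivIco 1 a hx)⟩

/-- Each component misses a point of the circle, and so does a clopen neighbourhood of it, where a
section of the covering lifts `q`. Finitely many such lifts are glued along clopen sets without any
matching condition. -/
theorem exists_continuous_lift {Y : Type*} [TopologicalSpace Y] [CompactSpace Y] [T2Space Y]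
    {q : Y → Circ} (hq : Continuous q) (hno : ∀ y, q '' connectedComponent y ≠ univ) :
    ∃ p : Y → ℝ, Continuous p ∧ ∀ y, (p y : Circ) = q y := by
  classical
  have key : ∃ W : Set Y, IsClopen W ∧ univ ⊆ W ∧ ∃ p : Y → ℝ,
      ∀ y ∈ W, ContinuousAt p y ∧ (p y : Circ) = q y := by
    refine isCompact_univ.induction_on (p := fun s => ∃ W : Set Y, IsClopen W ∧ s ⊆ W ∧
      ∃ p : Y → ℝ, ∀ y ∈ W, ContinuousAt p y ∧ (p y : Circ) = q y) ?_ ?_ ?_ ?_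
    · exact ⟨∅, isClopen_empty, Subset.rfl, fun _ => 0, by simp⟩
    · rintro s t hst ⟨W, hW, htW, h⟩
      exact ⟨W, hW, hst.trans htW, h⟩
    · rintro s t ⟨W, hW, hsW, p, hp⟩ ⟨W', hW', htW', p', hp'⟩
      refine ⟨W ∪ W', hW.union hW', union_subset_union hsW htW', W.piecewise p p', ?_⟩
      intro y hy
      by_cases hyW : y ∈ W
      · refine ⟨(hp y hyW).1.congr ?_, ?_⟩
        · filter_upwards [hW.isOpen.mem_nhds hyW] with x hx
          rw [piecewise_eq_of_mem _ _ _ hx]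
        · rw [piecewise_eq_of_mem _ _ _ hyW]
          exact (hp y hyW).2
      · have hyW' := hy.resolve_left hyW
        refine ⟨(hp' y hyW').1.congr ?_, ?_⟩
        · filter_upwards [hW.compl.isOpen.mem_nhds hyW] with x hx
          rw [piecewise_eq_of_notMem _ _ _ hx]
        · rw [piecewise_eq_of_notMem _ _ _ hyW]
          exact (hp' y hyW').2
    · intro y _
      obtain ⟨θ, hθ⟩ := (ne_univ_iff_exists_notMem _).1 (hno y)
      obtain ⟨a, rfl⟩ := QuotientAddGroup.mk_surjective θ
      obtain ⟨s, hs, -, hsc⟩ := exists_section a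
      obtain ⟨W, hW, hyW, hWO⟩ := exists_isClopen_between
        (isOpen_compl_singleton.preimage hq : IsOpen (q ⁻¹' {(a : Circ)}ᶜ))
        (fun x hx (hxa : q x = a) => hθ ⟨x, hx, hxa⟩)
      exact ⟨W, mem_nhdsWithin_of_mem_nhds (hW.isOpen.mem_nhds hyW), W, hW, Subset.rfl, s ∘ q,
        fun x hx => ⟨ContinuousAt.comp (hsc _ (hWO hx)) hq.continuousAt, hs _⟩⟩
  obtain ⟨W, -, hW, p, hp⟩ := key
  exact ⟨p, continuous_iff_continuousAt.2 fun y => (hp y (hW (mem_univ y))).1,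
    fun y => (hp y (hW (mem_univ y))).2⟩

theorem exists_int_of_coe_eq_zero {x : ℝ} (h : (x : Circ) = 0) : ∃ k : ℤ, (k : ℝ) = x := by
  obtain ⟨k, hk⟩ := (AddCircle.coe_eq_zero_iff 1).1 h
  exact ⟨k, by simpa using hk⟩

theorem _root_.IsPreconnected.eq_of_coe_eq_zero {Y : Type*} [TopologicalSpace Y] {S : Set Y}
    (hS : IsPreconnected S) {h : Y → ℝ} (hc : ContinuousOn h S)
    (h0 : ∀ y ∈ S, (h y : Circ) = 0) {x y : Y} (hx : x ∈ S) (hy : y ∈ S) : h x = h y := by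
  exact hS.constant_of_mapsTo
    (Int.isClosedEmbedding_coe_real.isEmbedding.isInducing.isDiscrete_range) hc
    (fun w hw => exists_int_of_coe_eq_zero (h0 w hw)) hx hy

/-- In a minimal system over a rotation, if no component covers the circle then every component
lies over a single point. -/
theorem eq_of_mem_connectedComponent {Y : Type*} [TopologicalSpace Y] [CompactSpace Y] [T2Space Y]
    {φ : Y → Y} (hφ : Continuous φ)
    (hmin : ∀ N : Set Y, N.Nonempty → IsClosed N → MapsTo φ N N → N = univ)
    {ω : ℝ} {q : Y → Circ} (hq : Continuous q) (hqφ : ∀ y, q (φ y) = q y + (ω : Circ))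
    (hno : ∀ y, q '' connectedComponent y ≠ univ) {x y : Y} (hx : x ∈ connectedComponent y) :
    q x = q y := by
  obtain ⟨p, hp, hpq⟩ := exists_continuous_lift hq hno
  have hmin' (y : Y) : ∃ v ∈ connectedComponent y, ∀ w ∈ connectedComponent y, p v ≤ p w :=
    isClosed_connectedComponent.isCompact.exists_isMinOn ⟨y, mem_connectedComponent⟩
      hp.continuousOn
  choose v hv hvle using hmin'
  have hvp {x y : Y} (h : x ∈ connectedComponent y) : p (v x) = p (v y) := by
    have h' := connectedComponent_eq h
    apply le_antisymm
    · exact hvle x _ (h' ▸ hv y)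
    · exact hvle y _ (h' ▸ hv x)
  -- The height of `y` above the lowest point of its component does not decrease under `φ`: on a
  -- component `p ∘ φ - p - ω` is integer-valued, hence constant.
  have hmono (y : Y) : p y - p (v y) ≤ p (φ y) - p (v (φ y)) := by
    have h1 := isPreconnected_connectedComponent.eq_of_coe_eq_zero
      (h := fun w => p (φ w) - p w - ω) (by fun_prop) (fun w _ => by
        simp only [AddCircle.coe_sub]
        rw [hpq, hpq, hqφ]
        abel) (hv y) (mem_connectedComponent (x := y))
    have h2 := hvle (φ y) (φ (v y)) (hφ.mapsTo_connectedComponent y (hv y))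
    linarith
  -- The height is upper semicontinuous: components of nearby points lie in a clopen set on which `p
  -- > d`.
  have hclosed (c : ℝ) : IsClosed {y | c ≤ p y - p (v y)} := by
    rw [← isOpen_compl_iff, isOpen_iff_mem_nhds]
    intro y hy
    simp only [mem_compl_iff, mem_ofPred_eq, not_le] at hy
    obtain ⟨d, hd1, hd2⟩ := exists_between (show p y - c < p (v y) by linarith)
    obtain ⟨W, hW, hyW, hWO⟩ := exists_isClopen_between
      (isOpen_Ioi.preimage hp : IsOpen (p ⁻¹' Ioi d))
      (fun x hx => lt_of_lt_of_le hd2 (hvle y x hx))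
    filter_upwards [hW.isOpen.mem_nhds hyW,
      (hp.tendsto y).eventually (gt_mem_nhds (show p y < c + d by linarith))] with x hx hx'
    have h3 : d < p (v x) := hWO (hW.connectedComponent_subset hx (hv x))
    simp only [mem_compl_iff, mem_ofPred_eq, not_le]
    linarith
  -- The closed invariant set of points at least as high as `y` is everything, so it contains `v y`,
  -- whose height is 0.
  have hle (y : Y) : p y ≤ p (v y) := by
    have h := hmin {w | p y - p (v y) ≤ p w - p (v w)} ⟨y, le_refl (p y - p (v y))⟩ (hclosed _)
      (fun w hw => le_trans hw (hmono w))
    have h2 : v y ∈ {w | p y - p (v y) ≤ p w - p (v w)} := h ▸ mem_univ _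
    have h3 : p y - p (v y) ≤ p (v y) - p (v (v y)) := h2
    rw [hvp (hv y)] at h3
    linarith
  have heq : p x = p y := by
    apply le_antisymm
    · exact (hle x).trans ((hvp hx).le.trans (hvle y y mem_connectedComponent))
    · exact (hle y).trans (hvle y x hx)
  rw [← hpq, ← hpq, heq]

theorem IsMinimalSet.component_fst {ω : ℝ} {f : Circ × Circ → Circ × Circ}
    (hfc : Continuous f) (hf : ∀ w, (f w).1 = w.1 + (ω : Circ)) {M : Set (Circ × Circ)}
    (hM : IsMinimalSet f M)
    (hno : ∀ C ⊆ M, IsPreconnected C → Prod.fst '' C ≠ univ) {z : Circ × Circ} (hz : z ∈ M) :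
    ∃ θ : Circ, Prod.fst '' connectedComponentIn M z = {θ} := by
  have : CompactSpace M := isCompact_iff_compactSpace.1 hM.isClosed.isCompact
  have key {x y : M} (hx : x ∈ connectedComponent y) : x.1.1 = y.1.1 := by
    refine eq_of_mem_connectedComponent (φ := hM.mapsTo.restrict f M M)
      (hfc.restrict hM.mapsTo) (fun N hN hNc hNφ => ?_) (q := fun y : M => y.1.1)
      (by fun_prop) (ω := ω) (fun y => hf y) (fun y h => ?_) hx
    · have h1 := hM.eq_of_subset (Subtype.val '' N) (by rintro _ ⟨w, -, rfl⟩; exact w.2)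
        (hN.image _) (hM.isClosed.isClosedEmbedding_subtypeVal.isClosedMap N hNc) (by
          rintro _ ⟨w, hw, rfl⟩
          exact ⟨_, hNφ hw, rfl⟩)
      refine eq_univ_of_forall fun w => ?_
      obtain ⟨w', hw', h⟩ : (w : Circ × Circ) ∈ Subtype.val '' N := h1.symm ▸ w.2
      rwa [← Subtype.ext h]
    · refine hno (Subtype.val '' connectedComponent y) (by rintro _ ⟨w, -, rfl⟩; exact w.2)
        (isPreconnected_connectedComponent.image _ continuous_subtype_val.continuousOn) ?_
      rw [← h, image_image]
  refine ⟨z.1, ?_⟩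
  rw [connectedComponentIn_eq_image hz, image_image]
  refine Subset.antisymm ?_ ?_
  · rintro _ ⟨x, hx, rfl⟩
    exact key hx
  · rintro _ rfl
    exact ⟨⟨z, hz⟩, mem_connectedComponent, rfl⟩

theorem sinCirc_coe (x : ℝ) : sinCirc x = Real.sin (2 * Real.pi * x) := rfl

/-- Strong forcing prevents connected sets that avoid a plateau, and whose images do so too, from
covering the base. -/
theorem fst_image_ne_univ {ω : Circ} {β : ℝ} (hβ : 1 ≤ |β|) {g : ℝ → ℝ} (hg : IsMonoLift g)
    {v : ℝ} (hv : v ∈ plateau g) {M : Set (Circ × Circ)}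
    (hM : proj ⁻¹' M ⊆ avoidSet ω (fun θ => β * sinCirc θ) g)
    {C : Set (Circ × Circ)} (hCM : C ⊆ M) (hC : IsPreconnected C) : Prod.fst '' C ≠ univ := by
  intro hfull
  obtain ⟨s, hs, hsI, hsc⟩ := exists_section v
  have hmem (w : Circ × Circ) (hw : w ∈ C) :
      (w.1, s w.2) ∈ avoidSet ω (fun θ => β * sinCirc θ) g := hM (by
    change (w.1, (s w.2 : Circ)) ∈ M
    rw [hs]
    exact hCM hw)
  have hne (w : Circ × Circ) (hw : w ∈ C) : w.2 ≠ (v : Circ) := by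
    intro h
    have h1 : ((s w.2 - v : ℝ) : Circ) = 0 := by rw [AddCircle.coe_sub, hs, h, sub_self]
    obtain ⟨k, hk⟩ := exists_int_of_coe_eq_zero h1
    have h2 := add_int_mem_plateau hg.add_one hv k
    rw [show v + k = s w.2 by linarith] at h2
    exact hmem w hw 0 h2
  let Y : Circ × Circ → ℝ := fun w => g (s w.2) + β * sinCirc w.1
  have hYc : ContinuousOn Y C := by
    intro w hw
    have h1 : ContinuousAt (fun w : Circ × Circ => s w.2) w :=
      ContinuousAt.comp (hsc _ (hne w hw)) continuousAt_snd
    exact ((hg.cont.continuousAt.comp h1).add (continuousAt_const.mul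
      (continuous_sinCirc.continuousAt.comp continuousAt_fst))).continuousWithinAt
  have hYv (w : Circ × Circ) (hw : w ∈ C) (k : ℤ) : Y w ≠ v + k := by
    intro h
    have := skew_mem_avoidSet (hmem w hw) 0
    simp only [skew, Function.iterate_zero, id] at this
    exact this ((show g (s w.2) + β * sinCirc w.1 = v + k from h) ▸
      add_int_mem_plateau hg.add_one hv k)
  -- `Y` is continuous on the connected set `C` and omits `v + ℤ`.
  have hosc {w w' : Circ × Circ} (hw : w ∈ C) (hw' : w' ∈ C) : Y w' < Y w + 1 := by
    by_contra! hle
    have h1 : v + (⌈Y w - v⌉ : ℤ) ∈ Icc (Y w) (Y w') := by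
      have := Int.le_ceil (Y w - v)
      have := Int.ceil_lt_add_one (Y w - v)
      constructor <;> linarith
    obtain ⟨u, hu, hu'⟩ := hC.intermediate_value hw hw' hYc h1
    exact hYv u hu _ hu'
  have hgosc (x y : Circ) : g (s x) ≤ g (s y) + 1 := by
    rw [← hg.add_one]
    exact hg.mono (by linarith [(hsI x).2, (hsI y).1])
  -- Over `±1/4` the forcing equals `±β`: a gap of `2|β| ≥ 2`, of which `g` can cancel at most 1.
  obtain ⟨w, hw, hw1⟩ : ((1 / 4 : ℝ) : Circ) ∈ Prod.fst '' C := hfull ▸ mem_univ _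
  obtain ⟨w', hw', hw1'⟩ : ((-(1 / 4) : ℝ) : Circ) ∈ Prod.fst '' C := hfull ▸ mem_univ _
  have e1 : Y w = g (s w.2) + β := by
    simp only [Y, hw1, sinCirc_coe]
    rw [show 2 * Real.pi * (1 / 4) = Real.pi / 2 by ring, Real.sin_pi_div_two, mul_one]
  have e2 : Y w' = g (s w'.2) - β := by
    simp only [Y, hw1', sinCirc_coe]
    rw [show 2 * Real.pi * (-(1 / 4)) = -(Real.pi / 2) by ring, Real.sin_neg,
      Real.sin_pi_div_two]
    ring
  have h1 := hosc hw hw'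
  have h2 := hosc hw' hw
  have h3 := hgosc w.2 w'.2
  have h4 := hgosc w'.2 w.2
  rcases le_abs.1 hβ with h | h <;> linarith

/-! ### Comparison of fibre maps and the rotation interval. -/

section

variable {ω : Circ} {b : Circ → ℝ} {g G : ℝ → ℝ}

/-- Only the upper map need be monotone. The gain `c` is a natural number because the accumulated
shift `n * c` must commute with `g`. -/
theorem iterate_skew_add_le (hg : IsMonoLift g) {c : ℕ} (h : ∀ x, G x + c ≤ g x) (n : ℕ)
    (z : Circ × ℝ) : ((skew ω b G)^[n] z).2 + n * c ≤ ((skew ω b g)^[n] z).2 := by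
  induction n with
  | zero => simp
  | succ n ih =>
    rw [Function.iterate_succ_apply', Function.iterate_succ_apply']
    simp only [skew, iterate_skew_fst]
    have h1 := hg.mono ih
    have h2 := map_add_int hg.add_one ((skew ω b G)^[n] z).2 (n * c : ℕ)
    have h3 := h ((skew ω b G)^[n] z).2
    push_cast at *
    linarith

theorem iterate_skew_le (hg : Monotone g) (h : ∀ x, g x ≤ G x) (n : ℕ) (z : Circ × ℝ) :
    ((skew ω b g)^[n] z).2 ≤ ((skew ω b G)^[n] z).2 := by
  induction n with
  | zero => simp
  | succ n ih =>
    rw [Function.iterate_succ_apply', Function.iterate_succ_apply']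
    simp only [skew, iterate_skew_fst]
    linarith [hg ih, h ((skew ω b G)^[n] z).2]

theorem iterate_skew_eq_of_mem_avoidSet (hgG : ∀ x ∉ plateau g, g x = G x) {z : Circ × ℝ}
    (hz : z ∈ avoidSet ω b g) (n : ℕ) : (skew ω b G)^[n] z = (skew ω b g)^[n] z := by
  induction n with
  | zero => rfl
  | succ n ih =>
    rw [Function.iterate_succ_apply', Function.iterate_succ_apply', ih, skew, skew, hgG _ (hz n)]

/-- A monotone modification of the fibre map yields minimal sets of the original system with the
rotation number of the modified one and zero entropy. -/
theorem exists_isMinimalSet_rotation (hb : Continuous b) (hg : IsMonoLift g)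
    (hgG : ∀ x ∉ plateau g, g x = G x) {ρ : ℝ}
    (hρ : TendstoUniformly (avgDisp (skew ω b g)) (fun _ => ρ) atTop)
    {f : Circ × Circ → Circ × Circ} (hf : ∀ z, f (proj z) = proj (skew ω b G z)) :
    ∃ M, IsMinimalSet f M ∧ proj ⁻¹' M ⊆ avoidSet ω b g ∧
      HasUniformRotation (skew ω b G) M ρ ∧ ZeroEntropyOn f M := by
  have hf' (z : Circ × ℝ) (hz : z ∈ avoidSet ω b g) : f (proj z) = proj (skew ω b g z) := by
    rw [hf]
    exact congrArg proj (iterate_skew_eq_of_mem_avoidSet hgG hz 1)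
  obtain ⟨M, hM, hMa⟩ := exists_isMinimalSet_avoiding hb hg hf'
  refine ⟨M, hM, hMa, ?_,
    zeroEntropyOn_of_skew hb hg hM.nonempty hM.mapsTo fun z hz => hf' z (hMa hz)⟩
  refine hρ.tendstoUniformlyOn.congr (Eventually.of_forall fun n z hz => ?_)
  simp only [avgDisp]
  rw [iterate_skew_eq_of_mem_avoidSet hgG (hMa hz)]

end

theorem exists_pour_rotation {ω : ℝ} (hω : Irrational ω) {b : Circ → ℝ} (hb : Continuous b)
    {G : ℝ → ℝ} (hc : Continuous G) (h1 : ∀ x, G (x + 1) = G x + 1) {R : ℝ} (hR0 : 0 ≤ R)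
    (hR : ∀ x, G x ≤ runInf G x + R) {ρ₁ ρ₂ : ℝ}
    (hρ₁ : TendstoUniformly (avgDisp (skew ω b (runInf G))) (fun _ => ρ₁) atTop)
    (hρ₂ : TendstoUniformly (avgDisp (skew ω b (runSup G))) (fun _ => ρ₂) atTop)
    {ρ : ℝ} (hρ : ρ ∈ Icc ρ₁ ρ₂) :
    ∃ μ, 0 ≤ μ ∧ TendstoUniformly (avgDisp (skew ω b (pour G μ))) (fun _ => ρ) atTop := by
  choose r hr using fun μ : Icc (0 : ℝ) R => exists_rotation hω hb (isMonoLift_pour hc h1 μ)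
  have hrc : Continuous r := continuous_rotation (g := fun μ : Icc (0 : ℝ) R => pour G μ) hb
    (fun μ => isMonoLift_pour hc h1 μ)
    ((continuous_pour hc h1).comp (by fun_prop :
      Continuous fun p : Icc (0 : ℝ) R × ℝ => ((p.1 : ℝ), p.2))) hr
  have : PreconnectedSpace (Icc (0 : ℝ) R) := Subtype.preconnectedSpace isPreconnected_Icc
  have e1 : r ⟨0, le_rfl, hR0⟩ = ρ₁ := by
    have h := (hr ⟨0, le_rfl, hR0⟩).tendsto_at (0, 0)
    rw [pour_zero hc h1] at h
    exact tendsto_nhds_unique h (hρ₁.tendsto_at (0, 0))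
  have e2 : r ⟨R, hR0, le_rfl⟩ = ρ₂ := by
    have h := (hr ⟨R, hR0, le_rfl⟩).tendsto_at (0, 0)
    rw [pour_of_le hR] at h
    exact tendsto_nhds_unique h (hρ₂.tendsto_at (0, 0))
  obtain ⟨μ, hμ⟩ := intermediate_value_univ ⟨0, le_rfl, hR0⟩ ⟨R, hR0, le_rfl⟩ hrc
    (show ρ ∈ Icc (r ⟨0, le_rfl, hR0⟩) (r ⟨R, hR0, le_rfl⟩) by rwa [e1, e2])
  exact ⟨μ, μ.2.1, hμ ▸ hr μ⟩

theorem HasUniformRotation.tendsto {F : Circ × ℝ → Circ × ℝ} {M : Set (Circ × Circ)} {ρ : ℝ}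
    (h : HasUniformRotation F M ρ) {z : Circ × ℝ} (hz : proj z ∈ M) :
    Tendsto (fun n => avgDisp F n z) atTop (𝓝 ρ) :=
  TendstoUniformlyOn.tendsto_at h hz

/-- The fibred rotation interval is bounded by the rotation numbers of the extremal monotone
modifications of the fibre map. -/
theorem fibRot_skew {ω : ℝ} (hω : Irrational ω) {b : Circ → ℝ} (hb : Continuous b)
    {G : ℝ → ℝ} (hc : Continuous G) (h1 : ∀ x, G (x + 1) = G x + 1) {R : ℝ} (hR0 : 0 ≤ R)
    (hR : ∀ x, G x ≤ runInf G x + R) {ρ₁ ρ₂ : ℝ}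
    (hρ₁ : TendstoUniformly (avgDisp (skew ω b (runInf G))) (fun _ => ρ₁) atTop)
    (hρ₂ : TendstoUniformly (avgDisp (skew ω b (runSup G))) (fun _ => ρ₂) atTop)
    {f : Circ × Circ → Circ × Circ} (hf : ∀ z, f (proj z) = proj (skew ω b G z)) :
    fibRot (skew ω b G) = Icc ρ₁ ρ₂ := by
  refine Subset.antisymm ?_ fun ρ hρ => ?_
  · rintro _ ⟨z, rfl⟩
    have t1 := hρ₁.tendsto_at z
    have t2 := hρ₂.tendsto_at z
    have le1 (n : ℕ) : avgDisp (skew ω b (runInf G)) n z ≤ avgDisp (skew ω b G) n z := by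
      simp only [avgDisp]
      gcongr
      exact iterate_skew_le (isMonoLift_runInf hc h1).mono (fun x => runInf_le hc h1 le_rfl) n z
    have le2 (n : ℕ) : avgDisp (skew ω b G) n z ≤ avgDisp (skew ω b (runSup G)) n z := by
      simp only [avgDisp]
      gcongr
      have := iterate_skew_add_le (ω := ω) (b := b) (isMonoLift_runSup hc h1) (c := 0)
        (fun x => by simpa using le_runSup hc h1 (le_refl x)) n z
      simpa using this
    have bdd : IsBoundedUnder (· ≤ ·) atTop fun n => avgDisp (skew ω b G) n z :=
      t2.isBoundedUnder_le.mono_le (Eventually.of_forall le2)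
    have bdd' : IsBoundedUnder (· ≥ ·) atTop fun n => avgDisp (skew ω b G) n z :=
      t1.isBoundedUnder_ge.mono_ge (Eventually.of_forall le1)
    constructor
    · rw [← t1.limsup_eq]
      exact limsup_le_limsup (Eventually.of_forall le1)
        t1.isBoundedUnder_ge.isCoboundedUnder_le bdd
    · rw [← t2.limsup_eq]
      exact limsup_le_limsup (Eventually.of_forall le2) bdd'.isCoboundedUnder_le
        t2.isBoundedUnder_le
  -- Conversely, every ρ in the interval is the limit along any orbit in a minimal set of a suitable
  -- `pour G μ`.
  · obtain ⟨μ, hμ, hμρ⟩ := exists_pour_rotation hω hb hc h1 hR0 hR hρ₁ hρ₂ hρ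
    obtain ⟨M, hM, -, hrot, -⟩ := exists_isMinimalSet_rotation hb (isMonoLift_pour hc h1 μ)
      (fun x hx => by
        by_contra hne
        exact hx (pour_eventually_const hc h1 hμ hne)) hμρ hf
    obtain ⟨w, hw⟩ := hM.nonempty
    obtain ⟨x, -, hx⟩ := exists_proj_eq w
    exact ⟨_, (hrot.tendsto (z := (w.1, x)) (hx.symm ▸ hw)).limsup_eq.symm⟩

/-! ### Application to the forced Arnold map. -/

/-- The fibre map of the forced Arnold map, without the forcing term. -/
def arnoldFibre (τ α x : ℝ) : ℝ := x + τ + α / (2 * Real.pi) * Real.sin (2 * Real.pi * x)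

section

variable (τ α : ℝ)

theorem arnoldLift_eq_skew (ω τ α β : ℝ) :
    arnoldLift ω τ α β = skew ω (fun θ => β * sinCirc θ) (arnoldFibre τ α) := rfl

theorem continuous_arnoldFibre : Continuous (arnoldFibre τ α) := by
  unfold arnoldFibre
  fun_prop

theorem arnoldFibre_add_one (x : ℝ) : arnoldFibre τ α (x + 1) = arnoldFibre τ α x + 1 := by
  have := sin_two_pi_periodic x
  simp only [arnoldFibre] at *
  rw [this]
  ring

theorem arnoldFibre_le_runInf (x : ℝ) :
    arnoldFibre τ α x ≤ runInf (arnoldFibre τ α) x + 2 * |α / (2 * Real.pi)| := by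
  obtain ⟨t, ht, h⟩ := exists_runInf_eq (continuous_arnoldFibre τ α) x
  rw [h]
  simp only [arnoldFibre]
  have key (y : ℝ) : |α / (2 * Real.pi) * Real.sin y| ≤ |α / (2 * Real.pi)| := by
    rw [abs_mul]
    exact mul_le_of_le_one_right (abs_nonneg _) (Real.abs_sin_le_one y)
  have k1 := abs_le.1 (key (2 * Real.pi * x))
  have k2 := abs_le.1 (key (2 * Real.pi * (x + t)))
  linarith [k1.2, k2.1, ht.1]

/-- Compare a translate of a sine peak to the left of `x` with a translate of a trough to its right.
The amplitude `|α| / (2π) ≥ 5/4` is exactly what both sign cases need. -/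
theorem runInf_add_one_le_runSup {α : ℝ} (hα : 5 / 2 * Real.pi ≤ |α|) (x : ℝ) :
    runInf (arnoldFibre τ α) x + 1 ≤ runSup (arnoldFibre τ α) x := by
  have hc := continuous_arnoldFibre τ α
  have h1 := arnoldFibre_add_one τ α
  have hA : 5 / 4 ≤ |α / (2 * Real.pi)| := by
    rw [abs_div, abs_of_pos Real.two_pi_pos, le_div_iff₀ Real.two_pi_pos]
    linarith
  have e1 : arnoldFibre τ α (1 / 4) = 1 / 4 + τ + α / (2 * Real.pi) := by
    rw [arnoldFibre, show 2 * Real.pi * (1 / 4) = Real.pi / 2 by ring, Real.sin_pi_div_two, mul_one]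
  have e2 : arnoldFibre τ α (3 / 4) = 3 / 4 + τ - α / (2 * Real.pi) := by
    rw [arnoldFibre, show 2 * Real.pi * (3 / 4) = Real.pi / 2 + Real.pi by ring,
      Real.sin_add_pi, Real.sin_pi_div_two]
    ring
  have key {y z : ℝ} (m n : ℤ) (hy : y + m ≤ x) (hz : x ≤ z + n)
      (h : arnoldFibre τ α z + n + 1 ≤ arnoldFibre τ α y + m) :
      runInf (arnoldFibre τ α) x + 1 ≤ runSup (arnoldFibre τ α) x := by
    have k1 := le_runSup hc h1 hy
    have k2 := runInf_le hc h1 hz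
    rw [map_add_int h1] at k1 k2
    linarith
  rcases le_abs.1 hA with h | h
  · have f1 := Int.floor_le (x - 1 / 4)
    have f2 := Int.lt_floor_add_one (x - 1 / 4)
    refine key (y := 1 / 4) (z := 3 / 4) ⌊x - 1 / 4⌋ (⌊x - 1 / 4⌋ + 1) ?_ ?_ ?_ <;>
      push_cast <;> linarith
  · have f1 := Int.floor_le (x - 3 / 4)
    have f2 := Int.lt_floor_add_one (x - 3 / 4)
    refine key (y := 3 / 4) (z := 1 / 4) ⌊x - 3 / 4⌋ (⌊x - 3 / 4⌋ + 2) ?_ ?_ ?_ <;>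
      push_cast <;> linarith

/-- The slope at `1/2` is `1 - α`. -/
theorem not_monotone_arnoldFibre {α : ℝ} (hα : 1 < α) : ¬ Monotone (arnoldFibre τ α) := by
  intro hm
  have hd : HasDerivAt (arnoldFibre τ α) (1 - α) (1 / 2) := by
    have h1 : HasDerivAt (fun x : ℝ => 2 * Real.pi * x) (2 * Real.pi) (1 / 2) := by
      simpa using (hasDerivAt_id (1 / 2 : ℝ)).const_mul (2 * Real.pi)
    have h2 := (((hasDerivAt_id (1 / 2 : ℝ)).add_const τ).add
      (h1.sin.const_mul (α / (2 * Real.pi))))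
    refine h2.congr_deriv ?_
    rw [show 2 * Real.pi * (1 / 2) = Real.pi by ring, Real.cos_pi]
    have := Real.pi_ne_zero
    field_simp
    ring
  have := hm.deriv_nonneg (x := 1 / 2)
  rw [hd.deriv] at this
  linarith

end

theorem continuous_arnold (ω τ α β : ℝ) : Continuous (arnold ω τ α β) := by
  have h := continuous_sinCirc
  have h2 : Continuous fun z : Circ × Circ =>
      ((τ + α / (2 * Real.pi) * sinCirc z.2 + β * sinCirc z.1 : ℝ) : Circ) :=
    (AddCircle.continuous_mk' 1).comp (by fun_prop)
  unfold arnold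
  fun_prop

theorem arnold_add_int (ω τ α β : ℝ) (k : ℤ) : arnold ω (τ + k) α β = arnold ω τ α β := by
  funext z
  simp only [arnold]
  rw [show τ + k + α / (2 * Real.pi) * sinCirc z.2 + β * sinCirc z.1 =
    τ + α / (2 * Real.pi) * sinCirc z.2 + β * sinCirc z.1 + k by ring, coe_add_int]

/-- Lifts of the forced Arnold map differ from the standard one by an integer. -/
theorem IsLift.exists_eq_arnoldLift {ω τ α β : ℝ} {F : Circ × ℝ → Circ × ℝ}
    (hF : IsLift (arnold ω τ α β) F) : ∃ k : ℤ, F = arnoldLift ω (τ + k) α β := by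
  have hp (z) : proj (F z) = proj (arnoldLift ω τ α β z) := by
    rw [hF.semiconj, (isLift_arnoldLift ω τ α β).semiconj]
  have h0 (z) : (((F z).2 - (arnoldLift ω τ α β z).2 : ℝ) : Circ) = 0 := by
    rw [AddCircle.coe_sub, sub_eq_zero]
    exact (Prod.ext_iff.1 (hp z)).2
  obtain ⟨k, hk⟩ := exists_int_of_coe_eq_zero (h0 (0, 0))
  have hcont : Continuous fun z => (F z).2 - (arnoldLift ω τ α β z).2 :=
    (continuous_snd.comp hF.continuous).sub
      (continuous_snd.comp (isLift_arnoldLift ω τ α β).continuous)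
  refine ⟨k, funext fun z => Prod.ext (Prod.ext_iff.1 (hp z)).1 ?_⟩
  have := isPreconnected_univ.eq_of_coe_eq_zero hcont.continuousOn (fun z _ => h0 z)
    (mem_univ z) (mem_univ (0, 0))
  rw [← hk] at this
  simp only [arnoldLift] at *
  linarith

theorem exists_fibRot_arnoldLift {ω : ℝ} (hω : Irrational ω) (τ α β : ℝ) :
    ∃ ρ₁ ρ₂ : ℝ, fibRot (arnoldLift ω τ α β) = Icc ρ₁ ρ₂ ∧
      (5 / 2 * Real.pi ≤ |α| → 1 ≤ ρ₂ - ρ₁) ∧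
      (1 < α → 1 ≤ |β| → ∀ ρ ∈ Icc ρ₁ ρ₂, ∃ M, IsStrangelyDispersed (arnold ω τ α β) M ∧
        HasUniformRotation (arnoldLift ω τ α β) M ρ ∧ ZeroEntropyOn (arnold ω τ α β) M) := by
  have hb : Continuous fun θ => β * sinCirc θ := continuous_const.mul continuous_sinCirc
  have hc := continuous_arnoldFibre τ α
  have h1 := arnoldFibre_add_one τ α
  have hR := arnoldFibre_le_runInf τ α
  have hR0 : 0 ≤ 2 * |α / (2 * Real.pi)| := by positivity
  have hf (z : Circ × ℝ) : arnold ω τ α β (proj z) =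
      proj (skew ω (fun θ => β * sinCirc θ) (arnoldFibre τ α) z) :=
    ((isLift_arnoldLift ω τ α β).semiconj z).symm
  obtain ⟨ρ₁, hρ₁⟩ := exists_rotation hω hb (isMonoLift_runInf hc h1)
  obtain ⟨ρ₂, hρ₂⟩ := exists_rotation hω hb (isMonoLift_runSup hc h1)
  rw [arnoldLift_eq_skew]
  refine ⟨ρ₁, ρ₂, fibRot_skew hω hb hc h1 hR0 hR hρ₁ hρ₂ hf, fun hα => ?_,
    fun hα hβ ρ hρ => ?_⟩
  · have hlim := (hρ₂.tendsto_at (0, 0)).sub (hρ₁.tendsto_at (0, 0))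
    refine ge_of_tendsto hlim ?_
    filter_upwards [eventually_gt_atTop 0] with n hn
    have hn' : (0 : ℝ) < n := by exact_mod_cast hn
    have := iterate_skew_add_le (ω := ω) (b := fun θ => β * sinCirc θ) (isMonoLift_runSup hc h1)
      (c := 1) (fun x => by simpa using runInf_add_one_le_runSup τ hα x) n (0, 0)
    simp only [avgDisp]
    rw [← sub_div, le_div_iff₀ hn']
    push_cast at this
    linarith
  · obtain ⟨μ, hμ, hμρ⟩ := exists_pour_rotation hω hb hc h1 hR0 hR hρ₁ hρ₂ hρ
    have hgG (x : ℝ) (hx : x ∉ plateau (pour (arnoldFibre τ α) μ)) :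
        pour (arnoldFibre τ α) μ x = arnoldFibre τ α x := by
      by_contra hne
      exact hx (pour_eventually_const hc h1 hμ hne)
    have hg := isMonoLift_pour hc h1 μ
    -- Without plateaus `pour` would coincide with the Arnold fibre map, which is not monotone for
    -- `α > 1`.
    obtain ⟨v, hv⟩ : (plateau (pour (arnoldFibre τ α) μ)).Nonempty := by
      by_contra! hempty
      refine not_monotone_arnoldFibre τ hα ?_
      rw [← funext fun x => hgG x (by simp [hempty])]
      exact hg.mono
    obtain ⟨M, hM, hMa, hrot, hent⟩ := exists_isMinimalSet_rotation hb hg hgG hμρ hf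
    refine ⟨M, ⟨hM.isClosed.isCompact, hM, fun z hz => ?_, fun z hz U hU hzU => ?_⟩, hrot, hent⟩
    · exact hM.component_fst (ω := ω) (continuous_arnold ω τ α β) (fun _ => rfl)
        (fun C hCM hC => fst_image_ne_univ hβ hg hv hMa hCM hC) hz
    · exact hM.dispersed hω (continuous_arnold ω τ α β) (fun _ => rfl) hz hU hzU

theorem disjoint_of_hasUniformRotation {F : Circ × ℝ → Circ × ℝ} {M M' : Set (Circ × Circ)}
    {ρ ρ' : ℝ} (h : HasUniformRotation F M ρ) (h' : HasUniformRotation F M' ρ') (hne : ρ ≠ ρ') :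
    Disjoint M M' := by
  rw [Set.disjoint_left]
  intro w hw hw'
  obtain ⟨x, -, hx⟩ := exists_proj_eq w
  exact hne (tendsto_nhds_unique (h.tendsto (z := (w.1, x)) (hx.symm ▸ hw))
    (h'.tendsto (hx.symm ▸ hw')))

end

end QPF

theorem theoremt (ω τ α β : ℝ) (hω : Irrational ω)
    (F : QPF.Circ × ℝ → QPF.Circ × ℝ) (hF : QPF.IsLift (QPF.arnold ω τ α β) F) :
    (1 < α → 3 / 2 ≤ |β| → ∀ ρ ∈ QPF.fibRot F, ∃ M : Set (QPF.Circ × QPF.Circ),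
      QPF.IsStrangelyDispersed (QPF.arnold ω τ α β) M ∧
      QPF.HasUniformRotation F M ρ ∧
      QPF.ZeroEntropyOn (QPF.arnold ω τ α β) M) ∧
    (5 / 2 * Real.pi ≤ |α| →
      (∃ ρ₁ ρ₂ : ℝ, QPF.fibRot F = Set.Icc ρ₁ ρ₂ ∧ 1 ≤ ρ₂ - ρ₁) ∧
      (interior (QPF.fibRot F)).Nonempty) ∧
    (1 < α → 3 / 2 ≤ |β| → 5 / 2 * Real.pi ≤ |α| →
      ∃ M : ℝ → Set (QPF.Circ × QPF.Circ),
        (∀ ρ ∈ QPF.fibRot F,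
          QPF.IsStrangelyDispersed (QPF.arnold ω τ α β) (M ρ) ∧
          QPF.HasUniformRotation F (M ρ) ρ ∧
          QPF.ZeroEntropyOn (QPF.arnold ω τ α β) (M ρ)) ∧
        (QPF.fibRot F).PairwiseDisjoint M ∧
        ¬ (M '' QPF.fibRot F).Countable) := by
  -- An arbitrary lift is the standard one with τ shifted by an integer, which leaves the torus map
  -- unchanged.
  obtain ⟨k, rfl⟩ := hF.exists_eq_arnoldLift
  obtain ⟨ρ₁, ρ₂, hI, hlen, hM⟩ := QPF.exists_fibRot_arnoldLift hω (τ + k) α β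
  rw [QPF.arnold_add_int] at hM
  rw [hI]
  refine ⟨fun hα hβ => hM hα (by linarith), fun hα => ⟨⟨ρ₁, ρ₂, rfl, hlen hα⟩, ?_⟩,
    fun hα hβ hα' => ?_⟩
  · rw [interior_Icc]
    exact Set.nonempty_Ioo.2 (by linarith [hlen hα])
  · choose! M hM' using hM hα (by linarith)
    have hdis : (Set.Icc ρ₁ ρ₂).PairwiseDisjoint M := fun ρ hρ ρ' hρ' hne =>
      QPF.disjoint_of_hasUniformRotation (hM' ρ hρ).2.1 (hM' ρ' hρ').2.1 hne
    refine ⟨M, hM', hdis, fun hcount => ?_⟩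
    -- Non-empty disjoint sets are distinct, so countably many of them would make a nondegenerate
    -- interval countable.
    have hinj : Set.InjOn M (Set.Icc ρ₁ ρ₂) := fun ρ hρ ρ' hρ' h => by
      by_contra hne
      have hd := hdis hρ hρ' hne
      simp only [Function.onFun, h, disjoint_self] at hd
      exact (hM' ρ' hρ').1.minimal.nonempty.ne_empty hd
    have hlt : ρ₁ < ρ₂ := by linarith [hlen hα']
    exact hlt.not_ge (Cardinal.Real.Icc_countable_iff.1
      (Set.countable_of_injective_of_countable_image hinj hcount))
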